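/- **Definitions.** A *set system* $(\mathcal U,\mathcal S)$ is a finite nonempty universe $\mathcal U$ with a finite family $\mathcal S$ of subsets; write $N=|\mathcal U|+|\mathcal S|$. "$k$ sets of $\mathcal S$" means $S_{i_1},\dots,S_{i_k}\in\mathcal S$ (repetitions allowed). A *2-CSP instance* $\Pi$ has finitely many variables $V$, a nonempty finite alphabet $\Sigma_v$ for each $v\in V$, a set $E$ of edges between distinct variables and, for each $e=(u,v)\in E$, a weight $w_e\in\mathbb N$ and a constraint $C_e\subseteq\Sigma_u\times\Sigma_v$, with $\sum_e w_e>0$. The value of an assignment $\psi$ is $\sum_{e=(u,v)\in E} w_e\mathbf 1[(\psi_u,\psi_v)\in C_e]\big/\sum_{e\in E} w_e$, and the value of $\Pi$ is the maximum over all assignments; $\Pi$ is *satisfiable* if some assignment satisfies all constraints. Algorithms are programs of a fixed model that is polynomially equivalent to Turing machines; a randomized algorithm gets independent fair random bits as additional input. **Theorem.** Let $\tau:\mathbb N\to(0,\infty)$ and $\delta:\mathbb N\to(0,1/2]$ be such that either both are computable sequences of real numbers, or both are constant (with arbitrary real values). Then there are a randomized algorithm $\mathcal A$, computable functions $T,\Gamma,\Lambda:\mathbb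 N\to\mathbb N$, polynomials $q,q'$, and a function $\mathrm{err}:\mathbb N\to\mathbb R$ with $\mathrm{err}(N)\to 0$ as $N\to\infty$, such that for every $k$ and every set system $(\mathcal U,\mathcal S)$ with $\mathcal U\neq\emptyset$: * *Running time.* On input $k,(\mathcal U,\mathcal S)$ the algorithm $\mathcal A$ halts within $T(k)\cdot q(N)$ steps, for every outcome of the random bits. * With probability at least $1-\mathrm{err}(N)$ it outputs a list $\Pi_1,\dots,\Pi_{\Gamma(k)}$ of 2-CSP instances with all of the following properties. * *Size.* Each $\Pi_i$ has exactly $\Lambda(k)$ variables, and all its alphabets have size at most $q'(N)$. * *Completeness.* If some $k$ sets of $\mathcal S$ have a union of size at least $\tau(k)|\mathcal U|$, then some $\Pi_i$ is satisfiable. * *Soundness.* If every $k$ sets of $\mathcal S$ have a union of size at most $(1-\delta(k))\tau(k)|\mathcal U|$, then every $\Pi_i$ has value at most $1-\delta(k)^2/4$. Moreover, suppose that $\delta$ is constant and that it is $\mathsf W[1]$-hard (under FPT reductions, parameter $k$) to distinguish set systems in which some $k$ sets cover at least a $\tau(k)$ fraction of the universe from those in which every $k$ sets cover at most a $(1-\delta)\tau(k)$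 fraction. Then it is $\mathsf W[1]$-hard under randomized FPT Turing reductions (parameter: the number of variables) to distinguish satisfiable 2-CSP instances from those of value at most $1-\delta^2/4$; that is, the Parameterized Inapproximability Hypothesis holds under such reductions. -/

import Mathlib

open Filter Topology

namespace MaxCovCSP

/-! ## Machine model

Programs of a small Lisp-like WHILE language over S-expressions, with unit cost for each executed
construct. Every construct allocates at most one cons cell (values are shared, never copied), and
the only test is comparison with `nil`. So the model is, up to a polynomial, equivalent in running
time to multitape Turing machines. -/

/-- S-expressions: the data on which programs operate. -/
inductive Data where
  | nil : Data
  | cons : Data → Data → Data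

namespace Data

def hd : Data → Data
  | nil => nil
  | cons a _ => a

def tl : Data → Data
  | nil => nil
  | cons _ b => b

/-- The number of nodes. -/
def size : Data → ℕ
  | nil => 1
  | cons a b => a.size + b.size + 1

def bit : Bool → Data
  | false => nil
  | true => cons nil nil

def list : List Data → Data
  | [] => nil
  | a :: l => cons a (list l)

/-- Numbers are written in unary. -/
def num (n : ℕ) : Data := list (List.replicate n nil)

end Data

/-- Programs; each one denotes a partial function from data to data. -/
inductive Prog where
  | id : Prog
  | nil : Prog
  | hd : Prog
  | tl : Prog
  | cons : Prog → Prog → Prog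
  | comp : Prog → Prog → Prog
  | cond : Prog → Prog → Prog → Prog
  | loop : Prog → Prog → Prog
  | query : Prog

/-- `Runs O p v w t`: with oracle `O`, the program `p` halts on input `v` with output `w` after
exactly `t` steps. `Prog.comp g f` runs `f`, then `g`; `Prog.cond c f g` runs `f` if the value of
`c` is not `nil`, and `g` otherwise; `Prog.loop c f` repeats `f` as long as the value of `c` on the
current state is not `nil`. -/
inductive Runs (O : Set Data) : Prog → Data → Data → ℕ → Prop
  | id (v : Data) : Runs O Prog.id v v 1
  | nil (v : Data) : Runs O Prog.nil v Data.nil 1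
  | hd (v : Data) : Runs O Prog.hd v v.hd 1
  | tl (v : Data) : Runs O Prog.tl v v.tl 1
  | cons {f g : Prog} {v a b : Data} {s t : ℕ} :
      Runs O f v a s → Runs O g v b t → Runs O (Prog.cons f g) v (Data.cons a b) (s + t + 1)
  | comp {g f : Prog} {v a b : Data} {s t : ℕ} :
      Runs O f v a s → Runs O g a b t → Runs O (Prog.comp g f) v b (s + t + 1)
  | cond_true {c f g : Prog} {v a b : Data} {s t : ℕ} :
      Runs O c v a s → a ≠ Data.nil → Runs O f v b t → Runs O (Prog.cond c f g) v b (s + t + 1)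
  | cond_false {c f g : Prog} {v b : Data} {s t : ℕ} :
      Runs O c v Data.nil s → Runs O g v b t → Runs O (Prog.cond c f g) v b (s + t + 1)
  | loop_done {c f : Prog} {v : Data} {s : ℕ} :
      Runs O c v Data.nil s → Runs O (Prog.loop c f) v v (s + 1)
  | loop_step {c f : Prog} {v a v' w : Data} {s t r : ℕ} :
      Runs O c v a s → a ≠ Data.nil → Runs O f v v' t → Runs O (Prog.loop c f) v' w r →
      Runs O (Prog.loop c f) v w (s + t + r + 1)
  | query_yes {v : Data} : v ∈ O → Runs O Prog.query v (Data.bit true) 1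
  | query_no {v : Data} : v ∉ O → Runs O Prog.query v (Data.bit false) 1

/-- A randomized program receives, next to its input `v`, a list of random bits. -/
def withCoins (v : Data) {R : ℕ} (r : Fin R → Bool) : Data :=
  Data.cons v (Data.list (List.ofFn fun i => Data.bit (r i)))

/-- The probability of the event `E` over `R` independent fair coin tosses. -/
noncomputable def coinProb (R : ℕ) (E : Set (Fin R → Bool)) : ℝ := (E.ncard : ℝ) / 2 ^ R

/-- A sequence of nonnegative reals is computable: `a k` can be approximated to within
`1 / (n + 1)`, uniformly in `k` and `n`. -/
def IsComputableSeq (a : ℕ → ℝ) : Prop :=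
  ∃ f : ℕ → ℕ → ℕ, Computable₂ f ∧
    ∀ k n : ℕ, |a k - (f k n : ℝ) / ((n : ℝ) + 1)| ≤ 1 / ((n : ℝ) + 1)

/-! ## Maximum coverage -/

/-- A set system: a finite universe `Fin u` and a finite family of subsets of it. -/
structure SetSystem where
  u : ℕ
  sets : List (Finset (Fin u))

namespace SetSystem

/-- The size measure `|U| + |S|`. -/
def size (I : SetSystem) : ℕ := I.u + I.sets.length

/-- The size of the union of the `k` sets with indices `i 0, …, i (k - 1)`. -/
def cover (I : SetSystem) {k : ℕ} (i : Fin k → Fin I.sets.length) : ℕ :=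
  (Finset.univ.biUnion fun j => I.sets.get (i j)).card

/-- `|U|`, followed by the list of the characteristic vectors of the sets. -/
def encode (I : SetSystem) : Data :=
  Data.cons (Data.num I.u)
    (Data.list (I.sets.map fun s =>
      Data.list (List.ofFn fun x : Fin I.u => Data.bit (decide (x ∈ s)))))

/-- Some `k` sets cover at least a `τ` fraction of the universe. -/
def CoversAtLeast (I : SetSystem) (k : ℕ) (τ : ℝ) : Prop :=
  ∃ i : Fin k → Fin I.sets.length, τ * (I.u : ℝ) ≤ (I.cover i : ℝ)

/-- Every `k` sets cover at most a `τ` fraction of the universe. -/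
def CoversAtMost (I : SetSystem) (k : ℕ) (τ : ℝ) : Prop :=
  ∀ i : Fin k → Fin I.sets.length, (I.cover i : ℝ) ≤ τ * (I.u : ℝ)

end SetSystem

/-! ## Weighted 2-CSP -/

/-- A weighted 2-CSP instance on the variables `Fin n`; the alphabet of `v` is `Fin (alph v)`.
Edges are loopless, and an edge `{u, v}` is recorded once, as `(u, v)` with `u < v`; `weight` and
`rel` are relevant on edges only. -/
structure CSP where
  n : ℕ
  alph : Fin n → ℕ
  alph_pos : ∀ v, 0 < alph v
  edge : Fin n → Fin n → Bool
  edge_lt : ∀ u v, edge u v = true → u < v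
  weight : Fin n → Fin n → ℕ
  rel : (u v : Fin n) → Fin (alph u) → Fin (alph v) → Bool
  weight_pos : 0 < ∑ u, ∑ v, if edge u v = true then weight u v else 0

namespace CSP

abbrev Assignment (P : CSP) : Type := (v : Fin P.n) → Fin (P.alph v)

/-- The assignment satisfies every constraint. -/
def Satisfies (P : CSP) (ψ : P.Assignment) : Prop :=
  ∀ u v, P.edge u v = true → P.rel u v (ψ u) (ψ v) = true

/-- The weighted fraction of the constraints that the assignment satisfies. -/
noncomputable def val (P : CSP) (ψ : P.Assignment) : ℝ :=
  (∑ u, ∑ v, if P.edge u v = true ∧ P.rel u v (ψ u) (ψ v) = true then (P.weight u v : ℝ) else 0) /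
    (∑ u, ∑ v, if P.edge u v = true then (P.weight u v : ℝ) else 0)

def Satisfiable (P : CSP) : Prop := ∃ ψ : P.Assignment, P.Satisfies ψ

/-- Every assignment has value at most `s`. -/
def ValueAtMost (P : CSP) (s : ℝ) : Prop := ∀ ψ : P.Assignment, P.val ψ ≤ s

/-- The number of variables, the alphabet sizes, and a square matrix whose entry at `(u, v)` holds
the weight and the truth table of the constraint on the edge `(u, v)`, or `nil` if there is no such
edge. -/
def encode (P : CSP) : Data :=
  Data.cons (Data.num P.n)
    (Data.cons (Data.list (List.ofFn fun v => Data.num (P.alph v)))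
      (Data.list (List.ofFn fun u => Data.list (List.ofFn fun v =>
        if P.edge u v = true then
          Data.cons (Data.num (P.weight u v))
            (Data.list (List.ofFn fun a => Data.list (List.ofFn fun b =>
              Data.bit (P.rel u v a b))))
        else Data.nil))))

end CSP

/-! ## Parameterized problems, reductions and hardness for W[1] -/

/-- A parameterized promise problem: the YES and the NO instances, for each parameter. -/
structure PromiseProblem where
  yes : ℕ → Set Data
  no : ℕ → Set Data

/-- A parameterized language, regarded as a promise problem. -/
def ofLanguage (L : ℕ → Set Data) : PromiseProblem where
  yes := L
  no := fun k => (L k)ᶜ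

/-- The deterministic many-one FPT reductions. -/
def FPTReduces (P Q : PromiseProblem) : Prop :=
  ∃ (p : Prog) (T g : ℕ → ℕ) (q : Polynomial ℕ), Computable T ∧ Computable g ∧
    ∀ (k : ℕ) (x : Data), x ∈ P.yes k ∪ P.no k →
      ∃ (k' : ℕ) (y : Data) (t : ℕ),
        Runs ∅ p (Data.cons (Data.num k) x) (Data.cons (Data.num k') y) t ∧
        t ≤ T k * q.eval x.size ∧ k' ≤ g k ∧
        (x ∈ P.yes k → y ∈ Q.yes k') ∧ (x ∈ P.no k → y ∈ Q.no k')

/-- The oracle `O` answers correctly on all instances of `Q` with parameter at most `m`. -/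
def Solves (O : Set Data) (Q : PromiseProblem) (m : ℕ) : Prop :=
  ∀ k ≤ m, ∀ y : Data,
    (y ∈ Q.yes k → Data.cons (Data.num k) y ∈ O) ∧ (y ∈ Q.no k → Data.cons (Data.num k) y ∉ O)

/-- The randomized FPT Turing reductions, with two-sided error at most `1/3`. The reduction may rely
only on the answers to queries whose parameter is at most `g k`. -/
def RandTuringReduces (P Q : PromiseProblem) : Prop :=
  ∃ (p : Prog) (T g : ℕ → ℕ) (q : Polynomial ℕ), Computable T ∧ Computable g ∧
    ∀ (k : ℕ) (x : Data), x ∈ P.yes k ∪ P.no k →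
      ∀ O : Set Data, Solves O Q (g k) → ∀ R : ℕ, T k * q.eval x.size ≤ R →
        (∀ r : Fin R → Bool, ∃ (w : Data) (t : ℕ),
          Runs O p (withCoins (Data.cons (Data.num k) x) r) w t ∧ t ≤ T k * q.eval x.size) ∧
        (x ∈ P.yes k → 2 / 3 ≤ coinProb R {r | ∃ (w : Data) (t : ℕ),
          Runs O p (withCoins (Data.cons (Data.num k) x) r) w t ∧ w ≠ Data.nil}) ∧
        (x ∈ P.no k → 2 / 3 ≤ coinProb R {r | ∃ t : ℕ,
          Runs O p (withCoins (Data.cons (Data.num k) x) r) Data.nil t})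

open Classical in
/-- The adjacency matrix of a graph. -/
noncomputable def encodeGraph {n : ℕ} (G : SimpleGraph (Fin n)) : Data :=
  Data.list (List.ofFn fun u => Data.list (List.ofFn fun v => Data.bit (decide (G.Adj u v))))

/-- The parameterized clique problem. -/
def clique (k : ℕ) : Set Data :=
  {x | ∃ (n : ℕ) (G : SimpleGraph (Fin n)), x = encodeGraph G ∧ ¬ G.CliqueFree k}

/-- The class W[1]: the closure of the parameterized clique problem under FPT reductions. -/
def W1 : Set (ℕ → Set Data) := {L | FPTReduces (ofLanguage L) (ofLanguage clique)}

/-- Hardness for W[1] (under FPT reductions). -/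
def W1Hard (Q : PromiseProblem) : Prop := ∀ L ∈ W1, FPTReduces (ofLanguage L) Q

/-- Hardness for W[1] under randomized FPT Turing reductions. -/
def W1HardRandTuring (Q : PromiseProblem) : Prop := ∀ L ∈ W1, RandTuringReduces (ofLanguage L) Q

/-- To distinguish whether some `k` sets cover at least a `τ k` fraction of the universe, or every
`k` sets cover at most a `(1 - δ) * τ k` fraction. -/
def gapMaxCov (τ : ℕ → ℝ) (δ : ℝ) : PromiseProblem where
  yes := fun k => {x | ∃ I : SetSystem, 0 < I.u ∧ x = I.encode ∧ I.CoversAtLeast k (τ k)}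
  no := fun k => {x | ∃ I : SetSystem, 0 < I.u ∧ x = I.encode ∧
    I.CoversAtMost k ((1 - δ) * τ k)}

/-- To distinguish whether a 2-CSP instance is satisfiable or has value at most `s`; the parameter
is the number of variables. -/
def gap2CSP (s : ℝ) : PromiseProblem where
  yes := fun k => {x | ∃ P : CSP, P.n = k ∧ x = P.encode ∧ P.Satisfiable}
  no := fun k => {x | ∃ P : CSP, P.n = k ∧ x = P.encode ∧ P.ValueAtMost s}

end MaxCovCSP

/-! Sample `numBlocks E k` blocks of about log N / log (k + 2) elements each. By a Chernoff bound
and a union bound over all choices of k sets, with probability 1 - O(1/N) the sample has the right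
density in every union of k sets, up to an error 2/E (`coinProb_representative`). Everything else is
deterministic, given such a sample.

A 2-CSP instance has a variable for each block, whose value labels every element of the block by 0
or by the index of a chosen set, and k variables for the chosen sets. There are at most k + 1 labels
and the blocks are short, so the alphabets are polynomial (`alphabet_le`). The edge between block j
and index i asks that at least a guessed number of elements of the block carry the label of i and
lie in the chosen set i. The guesses are not part of the assignment: there is one instance for each
table of guesses, in multiples of s/D, and the number of tables depends on k only. The weight of an
edge is its guess plus one, and all constraints fail unless the total weight reaches θ.

Completeness (`Sketch.exists_satisfiable`): the true counts of a good cover, rounded down, form a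
satisfied table, and the added ones make up for the rounding, so that the total reaches θ. Soundness
(`Sketch.valueAtMost`): each element has one label only, so the guesses on satisfied edges cannot
exceed the number of covered sample elements; with the added ones, the value is at most (E(1-δ)τ +
3)/t. The choice of E and t in `IsPrecision` makes this at most 1 - δ²/4.

Running times come from closure properties of `Ctx.Evaluates`. Computable functions of the parameter
enter through `exists_prog_of_computable`: the WHILE language simulates partial recursive codes with
a computable number of steps. For the hardness statement, the oracle is queried on each instance and
a single positive answer leads to acceptance. -/

namespace MaxCovCSP

/-! ### FPT-time evaluation over families of inputs -/

/-- A family of inputs of a program, with a parameter, a length, and an oracle for each. -/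
structure Ctx (ι : Type) where
  par : ι → ℕ
  len : ι → ℕ
  oracle : ι → Set Data
  env : ι → Data

namespace Ctx

variable {ι κ : Type} {Γ : Ctx ι}

/-- `b` is bounded by a computable function of the parameter times a polynomial in the length. -/
def Bounded (Γ : Ctx ι) (b : ι → ℕ) : Prop :=
  ∃ (T : ℕ → ℕ) (q : Polynomial ℕ), Computable T ∧ ∀ i, b i ≤ T (Γ.par i) * q.eval (Γ.len i)

/-- Some program computes `f i` from the input `Γ.env i` in FPT time. -/
def Evaluates (Γ : Ctx ι) (f : ι → Data) : Prop :=
  ∃ (p : Prog) (b : ι → ℕ), Γ.Bounded b ∧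
    ∀ i, ∃ t ≤ b i, Runs (Γ.oracle i) p (Γ.env i) (f i) t

namespace Bounded

theorem mono {a b : ι → ℕ} (hb : Γ.Bounded b) (h : ∀ i, a i ≤ b i) : Γ.Bounded a := by
  obtain ⟨T, q, hT, hq⟩ := hb
  exact ⟨T, q, hT, fun i => (h i).trans (hq i)⟩

theorem par {f : ℕ → ℕ} (hf : Computable f) : Γ.Bounded (fun i => f (Γ.par i)) :=
  ⟨f, 1, hf, fun i => by simp⟩

theorem len : Γ.Bounded Γ.len :=
  ⟨fun _ => 1, .X, Computable.const 1, fun i => by simp⟩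

theorem const (c : ℕ) : Γ.Bounded (fun _ => c) :=
  par (f := fun _ => c) (Computable.const c)

theorem add {a b : ι → ℕ} (ha : Γ.Bounded a) (hb : Γ.Bounded b) :
    Γ.Bounded (fun i => a i + b i) := by
  obtain ⟨T, q, hT, hq⟩ := ha
  obtain ⟨T', q', hT', hq'⟩ := hb
  refine ⟨fun k => T k + T' k, q + q', Primrec.nat_add.to_comp.comp hT hT', fun i => ?_⟩
  have h1 := hq i
  have h2 := hq' i
  rw [Polynomial.eval_add]
  nlinarith [Nat.zero_le (T (Γ.par i) * q'.eval (Γ.len i)),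
    Nat.zero_le (T' (Γ.par i) * q.eval (Γ.len i))]

theorem mul {a b : ι → ℕ} (ha : Γ.Bounded a) (hb : Γ.Bounded b) :
    Γ.Bounded (fun i => a i * b i) := by
  obtain ⟨T, q, hT, hq⟩ := ha
  obtain ⟨T', q', hT', hq'⟩ := hb
  refine ⟨fun k => T k * T' k, q * q', Primrec.nat_mul.to_comp.comp hT hT', fun i => ?_⟩
  rw [Polynomial.eval_mul]
  exact (Nat.mul_le_mul (hq i) (hq' i)).trans (le_of_eq (by ring))

theorem pow {a : ι → ℕ} (ha : Γ.Bounded a) (m : ℕ) : Γ.Bounded (fun i => a i ^ m) := by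
  induction m with
  | zero => simpa using const 1
  | succ m ih => simpa [pow_succ] using ih.mul ha

theorem eval {a : ι → ℕ} (ha : Γ.Bounded a) (q : Polynomial ℕ) :
    Γ.Bounded (fun i => q.eval (a i)) := by
  induction q using Polynomial.induction_on' with
  | add p q hp hq => simpa using hp.add hq
  | monomial n c => simpa using (const c).mul (ha.pow n)

theorem comap {b : ι → ℕ} (hb : Γ.Bounded b) {Δ : Ctx κ} (φ : κ → ι)
    (hp : ∀ x, Δ.par x = Γ.par (φ x)) (hl : ∀ x, Δ.len x = Γ.len (φ x)) :
    Δ.Bounded (fun x => b (φ x)) := by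
  obtain ⟨T, q, hT, hq⟩ := hb
  exact ⟨T, q, hT, fun x => by rw [hp, hl]; exact hq _⟩

end Bounded

/-- The same parameters, with the environment `f`. -/
def withEnv (Γ : Ctx ι) (f : ι → Data) : Ctx ι := { Γ with env := f }

/-- The context of the body of a loop: `n i` rounds, with the accumulator `acc i j` at the start of
the round `j`. -/
def loop (Γ : Ctx ι) (n : ι → ℕ) (acc : ι → ℕ → Data) : Ctx (Σ i, Fin (n i)) where
  par := fun x => Γ.par x.1
  len := fun x => Γ.len x.1
  oracle := fun x => Γ.oracle x.1
  env := fun x => Data.cons (acc x.1 x.2) (Data.cons (Data.num x.2) (Γ.env x.1))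

/-- The context with an additional bounded number. -/
def below (Γ : Ctx ι) (n : ι → ℕ) : Ctx (Σ i, Fin (n i)) where
  par := fun x => Γ.par x.1
  len := fun x => Γ.len x.1
  oracle := fun x => Γ.oracle x.1
  env := fun x => Data.cons (Data.num x.2) (Γ.env x.1)

theorem Bounded.lift_loop {b n : ι → ℕ} {acc : ι → ℕ → Data} (hb : Γ.Bounded b) :
    (Γ.loop n acc).Bounded (fun x => b x.1) :=
  hb.comap _ (fun _ => rfl) (fun _ => rfl)

theorem Bounded.lift_below {b n : ι → ℕ} (hb : Γ.Bounded b) :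
    (Γ.below n).Bounded (fun x => b x.1) :=
  hb.comap _ (fun _ => rfl) (fun _ => rfl)

namespace Evaluates

theorem of_eq {f g : ι → Data} (hf : Γ.Evaluates f) (h : ∀ i, f i = g i) : Γ.Evaluates g := by
  rwa [← funext h]

theorem env : Γ.Evaluates Γ.env :=
  ⟨.id, _, .const 1, fun _ => ⟨1, le_rfl, .id _⟩⟩

theorem comp {f g : ι → Data} (hf : Γ.Evaluates f) (hg : (Γ.withEnv f).Evaluates g) :
    Γ.Evaluates g := by
  obtain ⟨p, b, hb, hp⟩ := hf
  obtain ⟨p', b', hb', hp'⟩ := hg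
  refine ⟨p'.comp p, fun i => b i + b' i + 1, (hb.add hb').add (.const 1), fun i => ?_⟩
  obtain ⟨t, ht, h⟩ := hp i
  obtain ⟨t', ht', h'⟩ := hp' i
  exact ⟨_, by beta_reduce; omega, .comp h h'⟩

theorem cons {f g : ι → Data} (hf : Γ.Evaluates f) (hg : Γ.Evaluates g) :
    Γ.Evaluates (fun i => Data.cons (f i) (g i)) := by
  obtain ⟨p, b, hb, hp⟩ := hf
  obtain ⟨p', b', hb', hp'⟩ := hg
  refine ⟨p.cons p', fun i => b i + b' i + 1, (hb.add hb').add (.const 1), fun i => ?_⟩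
  obtain ⟨t, ht, h⟩ := hp i
  obtain ⟨t', ht', h'⟩ := hp' i
  exact ⟨_, by beta_reduce; omega, .cons h h'⟩

theorem hd {f : ι → Data} (hf : Γ.Evaluates f) : Γ.Evaluates (fun i => (f i).hd) :=
  hf.comp ⟨.hd, _, .const 1, fun _ => ⟨1, le_rfl, .hd _⟩⟩

theorem tl {f : ι → Data} (hf : Γ.Evaluates f) : Γ.Evaluates (fun i => (f i).tl) :=
  hf.comp ⟨.tl, _, .const 1, fun _ => ⟨1, le_rfl, .tl _⟩⟩

theorem nil : Γ.Evaluates (fun _ => Data.nil) :=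
  ⟨.nil, _, .const 1, fun _ => ⟨1, le_rfl, .nil _⟩⟩

theorem const (d : Data) : Γ.Evaluates (fun _ => d) := by
  induction d with
  | nil => exact nil
  | cons a b ha hb => exact ha.cons hb

theorem query {f : ι → Data} (hf : Γ.Evaluates f) (g : ι → Bool)
    (hg : ∀ i, g i = true ↔ f i ∈ Γ.oracle i) : Γ.Evaluates (fun i => Data.bit (g i)) := by
  refine hf.comp ⟨.query, _, .const 1, fun i => ⟨1, le_rfl, ?_⟩⟩
  change Runs (Γ.oracle i) _ (f i) (Data.bit (g i)) 1
  cases h : g i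
  · exact .query_no fun h' => by simp [(hg i).2 h'] at h
  · exact .query_yes ((hg i).1 h)

open Classical in
theorem cond {c f g : ι → Data} (hc : Γ.Evaluates c) (hf : Γ.Evaluates f) (hg : Γ.Evaluates g) :
    Γ.Evaluates (fun i => if c i = Data.nil then g i else f i) := by
  obtain ⟨p, b, hb, hp⟩ := hc
  obtain ⟨p', b', hb', hp'⟩ := hf
  obtain ⟨p'', b'', hb'', hp''⟩ := hg
  refine ⟨p.cond p' p'', fun i => b i + b' i + b'' i + 1,
    ((hb.add hb').add hb'').add (.const 1), fun i => ?_⟩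
  obtain ⟨t, ht, h⟩ := hp i
  obtain ⟨t', ht', h'⟩ := hp' i
  obtain ⟨t'', ht'', h''⟩ := hp'' i
  beta_reduce
  split_ifs with hi
  · rw [hi] at h
    exact ⟨_, by omega, .cond_false h h''⟩
  · exact ⟨_, by omega, .cond_true h hi h'⟩

/-- A program for one family serves every other family from whose environments the inputs of the
first can be computed. Lifting to loop bodies and nested contexts is a special case. -/
theorem comap {f : ι → Data} (hf : Γ.Evaluates f) {Δ : Ctx κ} (φ : κ → ι)
    (hp : ∀ x, Δ.par x = Γ.par (φ x)) (hl : ∀ x, Δ.len x = Γ.len (φ x))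
    (ho : ∀ x, Δ.oracle x = Γ.oracle (φ x)) (he : Δ.Evaluates (fun x => Γ.env (φ x))) :
    Δ.Evaluates (fun x => f (φ x)) := by
  obtain ⟨p, b, hb, h⟩ := hf
  refine he.comp ⟨p, _, hb.comap φ hp hl, fun x => ?_⟩
  obtain ⟨t, ht, hr⟩ := h (φ x)
  exact ⟨t, ht, by simpa [withEnv, ho] using hr⟩

theorem lift_loop {f : ι → Data} {n : ι → ℕ} {acc : ι → ℕ → Data} (hf : Γ.Evaluates f) :
    (Γ.loop n acc).Evaluates (fun x => f x.1) :=
  hf.comap _ (fun _ => rfl) (fun _ => rfl) (fun _ => rfl) env.tl.tl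

theorem lift_below {f : ι → Data} {n : ι → ℕ} (hf : Γ.Evaluates f) :
    (Γ.below n).Evaluates (fun x => f x.1) :=
  hf.comap _ (fun _ => rfl) (fun _ => rfl) (fun _ => rfl) env.tl

theorem loop_acc {n : ι → ℕ} {acc : ι → ℕ → Data} :
    (Γ.loop n acc).Evaluates (fun x => acc x.1 x.2) :=
  env.hd

theorem loop_idx {n : ι → ℕ} {acc : ι → ℕ → Data} :
    (Γ.loop n acc).Evaluates (fun x => Data.num x.2) :=
  env.tl.hd

theorem idx {n : ι → ℕ} : (Γ.below n).Evaluates (fun x => Data.num x.2) :=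
  env.hd

end Evaluates

end Ctx

/-! ### Iteration of a program along a list -/

theorem Data.num_succ (n : ℕ) : Data.num (n + 1) = Data.cons Data.nil (Data.num n) := rfl

theorem Data.num_zero : Data.num 0 = Data.nil := rfl

/-- Runs `p` once for each element of a list; the state consists of the rest of the list, the
accumulator, the number of completed rounds and an environment. -/
def Prog.iter (p : Prog) : Prog :=
  .loop .hd (.cons (.comp .tl .hd) (.cons (.comp p .tl)
    (.cons (.cons .nil (.comp .hd (.comp .tl .tl))) (.comp .tl (.comp .tl .tl)))))

/-- The list serves as a counter only; its elements are never inspected. The starting round j is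
general, since the induction along the list advances it. -/
theorem Runs.iter {O : Set Data} {p : Prog} {e : Data} {B : ℕ} (acc : ℕ → Data) (xs : List Data)
    (j : ℕ) (h : ∀ m, j ≤ m → m < j + xs.length →
      ∃ t ≤ B, Runs O p (Data.cons (acc m) (Data.cons (Data.num m) e)) (acc (m + 1)) t) :
    ∃ t ≤ xs.length * (B + 26) + 2,
      Runs O p.iter (Data.cons (Data.list xs) (Data.cons (acc j) (Data.cons (Data.num j) e)))
        (Data.cons Data.nil (Data.cons (acc (j + xs.length))
          (Data.cons (Data.num (j + xs.length)) e))) t := by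
  induction xs generalizing j with
  | nil => exact ⟨_, by simp, .loop_done (.hd _)⟩
  | cons x xs ih =>
    obtain ⟨t, ht, hr⟩ := h j le_rfl (by simp)
    obtain ⟨s, hs, hr'⟩ := ih (j + 1) fun m hm hm' => h m (by omega) (by simp at hm' ⊢; omega)
    have e1 : j + (x :: xs).length = j + 1 + xs.length := by simp; omega
    rw [e1]
    -- Apart from `p`, the bookkeeping of a round takes fewer than 26 steps.
    refine ⟨_, ?_, .loop_step (.hd _) (by simp [Data.hd, Data.list])
      (.cons (.comp (.hd _) (.tl _)) (.cons (.comp (.tl _) hr)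
        (.cons (.cons (.nil _) (.comp (.comp (.tl _) (.tl _)) (.hd _)))
          (.comp (.comp (.tl _) (.tl _)) (.tl _))))) hr'⟩
    simp only [List.length_cons]
    nlinarith

namespace Ctx

variable {ι κ : Type} {Γ : Ctx ι}

namespace Evaluates

theorem rec {xs : ι → List Data} {n : ι → ℕ} {acc : ι → ℕ → Data}
    (hxs : Γ.Evaluates (fun i => Data.list (xs i))) (hn : ∀ i, (xs i).length = n i)
    (hb : Γ.Bounded n) (h0 : Γ.Evaluates (fun i => acc i 0))
    (hs : (Γ.loop n acc).Evaluates (fun x => acc x.1 (x.2 + 1))) :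
    Γ.Evaluates (fun i => acc i (n i)) := by
  have hst := hxs.cons (h0.cons ((const (Data.num 0)).cons env))
  obtain ⟨p, b, ⟨T, q, hT, hq⟩, hp⟩ := hs
  -- The bound `b` may depend on the round. Its majorant does not, because all rounds inherit the
  -- parameter and the length of the input.
  have hB : Γ.Bounded (fun i => T (Γ.par i) * q.eval (Γ.len i)) :=
    ⟨T, q, hT, fun _ => le_rfl⟩
  have : (Γ.withEnv (fun i => Data.cons (Data.list (xs i)) (Data.cons (acc i 0)
      (Data.cons (Data.num 0) (Γ.env i))))).Evaluates
      (fun i => Data.cons Data.nil (Data.cons (acc i (n i))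
        (Data.cons (Data.num (n i)) (Γ.env i)))) := by
    refine ⟨p.iter, fun i => n i * (T (Γ.par i) * q.eval (Γ.len i) + 26) + 2,
      (hb.mul (hB.add (.const 26))).add (.const 2), fun i => ?_⟩
    have := Runs.iter (O := Γ.oracle i) (p := p) (e := Γ.env i)
      (B := T (Γ.par i) * q.eval (Γ.len i)) (acc i) (xs i) 0 fun m _ hm => by
        obtain ⟨t, ht, hr⟩ := hp ⟨i, ⟨m, by simpa [hn] using hm⟩⟩
        exact ⟨t, ht.trans (hq _), hr⟩
    simpa [hn, withEnv] using this
  exact (hst.comp this).tl.hd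

theorem natRec {n : ι → ℕ} {acc : ι → ℕ → Data}
    (hn : Γ.Evaluates (fun i => Data.num (n i))) (hb : Γ.Bounded n)
    (h0 : Γ.Evaluates (fun i => acc i 0))
    (hs : (Γ.loop n acc).Evaluates (fun x => acc x.1 (x.2 + 1))) :
    Γ.Evaluates (fun i => acc i (n i)) :=
  rec (xs := fun i => List.replicate (n i) Data.nil) hn (by simp) hb h0 hs

theorem length {xs : ι → List Data} (hxs : Γ.Evaluates (fun i => Data.list (xs i)))
    (hb : Γ.Bounded (fun i => (xs i).length)) :
    Γ.Evaluates (fun i => Data.num (xs i).length) :=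
  rec (acc := fun _ j => Data.num j) hxs (fun _ => rfl) hb (const _) (nil.cons loop_acc)

end Evaluates
end Ctx
-- Arithmetic on unary numbers
theorem Data.tl_num (n : ℕ) : (Data.num n).tl = Data.num (n - 1) := by
  cases n <;> rfl

theorem Data.num_eq_nil {n : ℕ} : Data.num n = Data.nil ↔ n = 0 := by
  cases n <;> simp [Data.num_succ, Data.num_zero]

/-- The entry with index `n` of a list, or `nil`. -/
def Data.nth (d : Data) (n : ℕ) : Data := (Data.tl^[n] d).hd

theorem Data.nth_list (xs : List Data) (n : ℕ) :
    (Data.list xs).nth n = xs.getD n Data.nil := by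
  induction n generalizing xs with
  | zero => cases xs <;> rfl
  | succ n ih =>
    cases xs with
    | nil => simpa [Data.nth, Data.list, Data.tl] using ih []
    | cons x xs => simpa [Data.nth, Data.list, Data.tl] using ih xs

theorem card_filter_range_lt {m n : ℕ} (h : m ≤ n) :
    ((Finset.range n).filter (fun x => x < m)).card = m := by
  have : (Finset.range n).filter (fun x => x < m) = Finset.range m := by
    ext x
    simp only [Finset.mem_filter, Finset.mem_range]
    omega
  rw [this, Finset.card_range]

namespace Ctx

variable {ι κ : Type} {Γ : Ctx ι}

/-- Some program computes the number `f i` in FPT time. -/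
abbrev EvalNat (Γ : Ctx ι) (f : ι → ℕ) : Prop := Γ.Evaluates (fun i => Data.num (f i))

/-- Some program computes the Boolean value `f i` in FPT time. -/
abbrev EvalBool (Γ : Ctx ι) (f : ι → Bool) : Prop := Γ.Evaluates (fun i => Data.bit (f i))

theorem Bounded.idx_below {n : ι → ℕ} (hb : Γ.Bounded n) :
    (Γ.below n).Bounded (fun x => (x.2 : ℕ)) :=
  hb.lift_below.mono fun x => x.2.2.le

theorem Bounded.idx_loop {n : ι → ℕ} {acc : ι → ℕ → Data} (hb : Γ.Bounded n) :
    (Γ.loop n acc).Bounded (fun x => (x.2 : ℕ)) :=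
  hb.lift_loop.mono fun x => x.2.2.le

theorem Evaluates.below_loop {n : ι → ℕ} {acc : ι → ℕ → Data} {f : (Σ i, Fin (n i)) → Data}
    (hf : (Γ.below n).Evaluates f) : (Γ.loop n acc).Evaluates f :=
  hf.comap (Δ := Γ.loop n acc) (fun x => x) (fun _ => rfl) (fun _ => rfl) (fun _ => rfl)
    Evaluates.env.tl

theorem Bounded.below_loop {n : ι → ℕ} {acc : ι → ℕ → Data} {f : (Σ i, Fin (n i)) → ℕ}
    (hf : (Γ.below n).Bounded f) : (Γ.loop n acc).Bounded f :=
  hf.comap (Δ := Γ.loop n acc) (fun x => x) (fun _ => rfl) (fun _ => rfl)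

namespace Evaluates

theorem ite {c : ι → Bool} {f g : ι → Data} (hc : Γ.EvalBool c) (hf : Γ.Evaluates f)
    (hg : Γ.Evaluates g) : Γ.Evaluates (fun i => if c i = true then f i else g i) :=
  (hc.cond hf hg).of_eq fun i => by cases h : c i <;> simp [Data.bit]

theorem nth {d : ι → Data} {n : ι → ℕ} (hd : Γ.Evaluates d) (hn : Γ.EvalNat n)
    (hb : Γ.Bounded n) : Γ.Evaluates (fun i => (d i).nth (n i)) :=
  (natRec (acc := fun i j => Data.tl^[j] (d i)) hn hb hd
    (loop_acc.tl.of_eq fun x => by rw [Function.iterate_succ_apply'])).hd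

theorem ofFn {n : ι → ℕ} {f : (Σ i, Fin (n i)) → Data} (hn : Γ.EvalNat n) (hb : Γ.Bounded n)
    (hf : (Γ.below n).Evaluates f) :
    Γ.Evaluates (fun i => Data.list (List.ofFn fun j : Fin (n i) => f ⟨i, j⟩)) := by
  -- Lists grow at the front, so the list is built from its end: after j rounds the accumulator is
  -- the suffix of length j, and the next entry has the index n - (j + 1).
  have key := natRec (Γ := Γ) (n := n)
    (acc := fun i j => Data.list ((List.ofFn fun j : Fin (n i) => f ⟨i, j⟩).drop (n i - j))) hn hb
    (nil.of_eq fun i => by simp [List.drop_eq_nil_of_le, Data.list]) ?_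
  · exact key.of_eq fun i => by simp
  have hsub : (Γ.loop n (fun i j =>
      Data.list ((List.ofFn fun j : Fin (n i) => f ⟨i, j⟩).drop (n i - j)))).EvalNat
      (fun x => n x.1 - (x.2 + 1)) :=
    (natRec (acc := fun x j => Data.num (n x.1 - j)) (nil.cons loop_idx)
      (hb.idx_loop.add (.const 1)) (Evaluates.lift_loop hn)
      (loop_acc.tl.of_eq fun x => by rw [Data.tl_num, Nat.sub_sub]))
  have hval := hf.comap (Δ := Γ.loop n (fun i j =>
      Data.list ((List.ofFn fun j : Fin (n i) => f ⟨i, j⟩).drop (n i - j))))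
      (fun x => ⟨x.1, n x.1 - (x.2 + 1), by have := x.2.2; omega⟩) (fun _ => rfl) (fun _ => rfl)
      (fun _ => rfl) (hsub.cons env.tl.tl)
  refine (hval.cons loop_acc).of_eq fun x => ?_
  obtain ⟨i, j, hj⟩ := x
  have hlt : n i - (j + 1) < (List.ofFn fun j : Fin (n i) => f ⟨i, j⟩).length := by
    simp only [List.length_ofFn]; omega
  rw [List.drop_eq_getElem_cons hlt, List.getElem_ofFn,
    show n i - (j + 1) + 1 = n i - j by omega]
  rfl

end Evaluates

namespace EvalNat

theorem of_eq {f g : ι → ℕ} (hf : Γ.EvalNat f) (h : ∀ i, f i = g i) : Γ.EvalNat g := by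
  rwa [← funext h]

theorem lift_loop {f : ι → ℕ} {n : ι → ℕ} {acc : ι → ℕ → Data} (hf : Γ.EvalNat f) :
    (Γ.loop n acc).EvalNat (fun x => f x.1) :=
  Evaluates.lift_loop hf

theorem lift_below {f : ι → ℕ} {n : ι → ℕ} (hf : Γ.EvalNat f) :
    (Γ.below n).EvalNat (fun x => f x.1) :=
  Evaluates.lift_below hf

theorem idx {n : ι → ℕ} : (Γ.below n).EvalNat (fun x => x.2) :=
  Evaluates.idx

theorem natRec {n : ι → ℕ} (acc : ι → ℕ → ℕ) (hn : Γ.EvalNat n) (hb : Γ.Bounded n)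
    (h0 : Γ.EvalNat (fun i => acc i 0))
    (hs : (Γ.loop n (fun i j => Data.num (acc i j))).EvalNat (fun x => acc x.1 x.2) →
      (Γ.loop n (fun i j => Data.num (acc i j))).EvalNat (fun x => acc x.1 (x.2 + 1))) :
    Γ.EvalNat (fun i => acc i (n i)) :=
  Evaluates.natRec (acc := fun i j => Data.num (acc i j)) hn hb h0 (hs Evaluates.loop_acc)

theorem const (n : ℕ) : Γ.EvalNat (fun _ => n) := Evaluates.const _

theorem succ {f : ι → ℕ} (hf : Γ.EvalNat f) : Γ.EvalNat (fun i => f i + 1) :=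
  Evaluates.nil.cons hf

theorem add {f g : ι → ℕ} (hf : Γ.EvalNat f) (hg : Γ.EvalNat g) (hb : Γ.Bounded g) :
    Γ.EvalNat (fun i => f i + g i) :=
  natRec (fun i j => f i + j) hg hb hf fun h => h.succ

theorem mul {f g : ι → ℕ} (hf : Γ.EvalNat f) (hbf : Γ.Bounded f) (hg : Γ.EvalNat g)
    (hb : Γ.Bounded g) : Γ.EvalNat (fun i => f i * g i) :=
  natRec (fun i j => f i * j) hg hb (const 0) fun h => h.add hf.lift_loop hbf.lift_loop

theorem sub {f g : ι → ℕ} (hf : Γ.EvalNat f) (hg : Γ.EvalNat g) (hb : Γ.Bounded g) :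
    Γ.EvalNat (fun i => f i - g i) :=
  natRec (fun i j => f i - j) hg hb hf fun h =>
    (Evaluates.tl h).of_eq fun x => by rw [Data.tl_num, Nat.sub_sub]

theorem ite {c : ι → Bool} {f g : ι → ℕ} (hc : Γ.EvalBool c) (hf : Γ.EvalNat f)
    (hg : Γ.EvalNat g) : Γ.EvalNat (fun i => if c i = true then f i else g i) :=
  (Evaluates.ite hc hf hg).of_eq fun i => by beta_reduce; split_ifs <;> rfl

end EvalNat

namespace EvalBool

theorem of_eq {f g : ι → Bool} (hf : Γ.EvalBool f) (h : ∀ i, f i = g i) : Γ.EvalBool g := by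
  rwa [← funext h]

theorem and {f g : ι → Bool} (hf : Γ.EvalBool f) (hg : Γ.EvalBool g) :
    Γ.EvalBool (fun i => f i && g i) :=
  (Evaluates.ite hf hg (.const (Data.bit false))).of_eq
    fun i => by beta_reduce; cases f i <;> simp

theorem le {f g : ι → ℕ} (hf : Γ.EvalNat f) (hg : Γ.EvalNat g) (hb : Γ.Bounded g) :
    Γ.EvalBool (fun i => decide (f i ≤ g i)) :=
  (Evaluates.cond (hf.sub hg hb) (.const (Data.bit false)) (.const (Data.bit true))).of_eq
    fun i => by
      beta_reduce
      by_cases h : f i ≤ g i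
      · simp [h, Data.num_eq_nil]
      · rw [if_neg (by rw [Data.num_eq_nil]; omega), decide_eq_false h]

theorem lt {f g : ι → ℕ} (hf : Γ.EvalNat f) (hg : Γ.EvalNat g) (hb : Γ.Bounded g) :
    Γ.EvalBool (fun i => decide (f i < g i)) :=
  le hf.succ hg hb

theorem eq {f g : ι → ℕ} (hf : Γ.EvalNat f) (hbf : Γ.Bounded f) (hg : Γ.EvalNat g)
    (hb : Γ.Bounded g) : Γ.EvalBool (fun i => decide (f i = g i)) :=
  of_eq (and (le hf hg hb) (le hg hf hbf)) fun i => by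
    rw [← Bool.decide_and, decide_eq_decide, ← le_antisymm_iff]

end EvalBool

namespace EvalNat

theorem min {f g : ι → ℕ} (hf : Γ.EvalNat f) (hg : Γ.EvalNat g) (hb : Γ.Bounded g) :
    Γ.EvalNat (fun i => min (f i) (g i)) :=
  of_eq (ite (.le hf hg hb) hf hg) fun i => by
    by_cases h : f i ≤ g i
    · simp [h]
    · simp [h, le_of_not_ge h]

theorem count {n : ι → ℕ} (P : ι → ℕ → Bool) (hn : Γ.EvalNat n) (hb : Γ.Bounded n)
    (hP : (Γ.below n).EvalBool (fun x => P x.1 x.2)) :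
    Γ.EvalNat (fun i => Nat.count (fun j => P i j = true) (n i)) :=
  natRec (fun i j => Nat.count (fun j => P i j = true) j) hn hb (const 0) fun h =>
    of_eq (ite (Evaluates.below_loop hP) h.succ h) fun x => by
      rw [Nat.count_succ]
      cases P x.1 x.2 <;> simp

theorem sum {n : ι → ℕ} (f : ι → ℕ → ℕ) (hn : Γ.EvalNat n) (hb : Γ.Bounded n)
    (hf : (Γ.below n).EvalNat (fun x => f x.1 x.2))
    (hbf : (Γ.below n).Bounded (fun x => f x.1 x.2)) :
    Γ.EvalNat (fun i => ∑ j ∈ Finset.range (n i), f i j) :=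
  natRec (fun i j => ∑ j ∈ Finset.range j, f i j) hn hb (const 0) fun h =>
    of_eq (add h (Evaluates.below_loop hf) hbf.below_loop) fun x => by rw [Finset.sum_range_succ]

/-- The quotient is the number of j < f with (j + 1) g ≤ f. -/
theorem div {f g : ι → ℕ} (hf : Γ.EvalNat f) (hbf : Γ.Bounded f) (hg : Γ.EvalNat g)
    (hbg : Γ.Bounded g) (hpos : ∀ i, 0 < g i) : Γ.EvalNat (fun i => f i / g i) := by
  refine of_eq (count (fun i j => decide ((j + 1) * g i ≤ f i)) hf hbf ?_) fun i => ?_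
  · have h1 : (Γ.below f).EvalNat fun x => ((x.2 : ℕ) + 1) * g x.1 :=
      mul (succ idx) (hbf.idx_below.add (.const 1)) hg.lift_below hbg.lift_below
    exact EvalBool.le h1 hf.lift_below hbf.lift_below
  have h : ∀ j, decide ((j + 1) * g i ≤ f i) = true ↔ j < f i / g i := fun j => by
    rw [decide_eq_true_iff, ← Nat.le_div_iff_mul_le (hpos i), Nat.succ_le_iff]
  simp only [h, Nat.count_eq_card_filter_range, card_filter_range_lt (Nat.div_le_self _ _)]

theorem mod {f g : ι → ℕ} (hf : Γ.EvalNat f) (hbf : Γ.Bounded f) (hg : Γ.EvalNat g)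
    (hbg : Γ.Bounded g) (hpos : ∀ i, 0 < g i) : Γ.EvalNat (fun i => f i % g i) :=
  of_eq (sub hf (mul hg hbg (div hf hbf hg hbg hpos)
    (hbf.mono fun _ => Nat.div_le_self _ _)) (hbf.mono fun _ => Nat.mul_div_le _ _))
    fun i => by rw [Nat.mod_eq_sub_mul_div]

/-- The cap keeps intermediate values bounded even where the power is not. It may be applied after
every multiplication, because a power that has reached the cap stays above it. -/
theorem minPow {b n c : ι → ℕ} (hb : Γ.EvalNat b) (hbb : Γ.Bounded b) (hn : Γ.EvalNat n)
    (hbn : Γ.Bounded n) (hc : Γ.EvalNat c) (hbc : Γ.Bounded c) (hpos : ∀ i, 0 < b i) :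
    Γ.EvalNat (fun i => Min.min (b i ^ n i) (c i)) := by
  refine natRec (fun i j => Min.min (b i ^ j) (c i)) hn hbn (min (const 1) hc hbc) fun h => ?_
  refine of_eq (min (mul h (hbc.lift_loop.mono fun x => min_le_right _ _) hb.lift_loop
    hbb.lift_loop) hc.lift_loop hbc.lift_loop) fun x => ?_
  have h1 := hpos x.1
  rw [pow_succ]
  rcases le_total (b x.1 ^ (x.2 : ℕ)) (c x.1) with h | h
  · rw [min_eq_left h]
  · rw [min_eq_right h, min_eq_right (Nat.le_mul_of_pos_right _ h1),
      min_eq_right (h.trans (Nat.le_mul_of_pos_right _ h1))]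

theorem pow {b n : ι → ℕ} (hb : Γ.EvalNat b) (hbb : Γ.Bounded b) (hn : Γ.EvalNat n)
    (hbn : Γ.Bounded n) (hpos : ∀ i, 0 < b i) (hbp : Γ.Bounded (fun i => b i ^ n i)) :
    Γ.EvalNat (fun i => b i ^ n i) :=
  natRec (fun i j => b i ^ j) hn hbn (const 1) fun h =>
    mul h (hbp.lift_loop.mono fun x => Nat.pow_le_pow_right (hpos _) x.2.2.le) hb.lift_loop
      hbb.lift_loop

/-- The logarithm counts the exponents j + 1 whose power is at most n. Capping the power at n + 1
does not affect this comparison. -/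
theorem log {b n : ι → ℕ} (hb : Γ.EvalNat b) (hbb : Γ.Bounded b) (hn : Γ.EvalNat n)
    (hbn : Γ.Bounded n) (h1 : ∀ i, 1 < b i) : Γ.EvalNat (fun i => Nat.log (b i) (n i)) := by
  refine of_eq (count (fun i j => decide (Min.min (b i ^ (j + 1)) (n i + 1) ≤ n i)) hn hbn ?_)
    fun i => ?_
  · have h2 : (Γ.below n).EvalNat fun x => Min.min (b x.1 ^ ((x.2 : ℕ) + 1)) (n x.1 + 1) :=
      minPow hb.lift_below hbb.lift_below (succ idx) (hbn.idx_below.add (.const 1))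
        hn.lift_below.succ (hbn.lift_below.add (.const 1)) fun x => zero_lt_one.trans (h1 x.1)
    exact EvalBool.le h2 hn.lift_below hbn.lift_below
  have h : ∀ j ∈ Finset.range (n i), decide (Min.min (b i ^ (j + 1)) (n i + 1) ≤ n i) = true ↔
      j < Nat.log (b i) (n i) := fun j hj => by
    rw [Finset.mem_range] at hj
    rw [decide_eq_true_iff, min_le_iff, or_iff_left (by omega),
      ← Nat.le_log_iff_pow_le (h1 i) (by omega), Nat.succ_le_iff]
  rw [Nat.count_eq_card_filter_range, Finset.filter_congr h,
    card_filter_range_lt (Nat.log_le_self _ _)]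

end EvalNat

end Ctx
-- Simulation of partial recursive codes with a count of the steps
open Turing.ToPartrec (Code)

/-- A list of numbers as data. -/
def Data.nums (v : List ℕ) : Data := Data.list (v.map Data.num)

theorem Data.hd_nums (v : List ℕ) : (Data.nums v).hd = Data.num v.headI := by
  cases v <;> rfl

theorem Data.tl_nums (v : List ℕ) : (Data.nums v).tl = Data.nums v.tail := by
  cases v <;> rfl

/-- `p` computes the function of `c`, and `g` computes the result together with the number of steps
that `p` needs. -/
def Simulates (p : Prog) (g : List ℕ →. ℕ × List ℕ) (c : Code) : Prop :=
  Partrec g ∧ ∀ O v w, w ∈ c.eval v →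
    ∃ t, (t, w) ∈ g v ∧ Runs O p (Data.nums v) (Data.nums w) t

theorem Simulates.total {p : Prog} {c : Code} {f : List ℕ → List ℕ} {T : ℕ} (hf : Computable f)
    (hc : ∀ v, c.eval v = pure (f v))
    (hp : ∀ O v, Runs O p (Data.nums v) (Data.nums (f v)) T) :
    ∃ p g, Simulates p g c := by
  refine ⟨p, fun v => Part.some (T, f v), ((Computable.const T).pair hf).partrec,
    fun O v w hw => ⟨T, ?_, ?_⟩⟩
  · rw [hc] at hw
    rw [Part.mem_some_iff.1 hw]
    exact Part.mem_some _
  · rw [hc] at hw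
    rw [Part.mem_some_iff.1 hw]
    exact hp O v

theorem Simulates.cons {p p' : Prog} {g g' : List ℕ →. ℕ × List ℕ} {c c' : Code}
    (h : Simulates p g c) (h' : Simulates p' g' c') : ∃ p g, Simulates p g (.cons c c') := by
  refine ⟨.cons (.comp .hd p) p', fun v => (g v).bind fun a => (g' v).map fun b =>
    (a.1 + 1 + 1 + b.1 + 1, a.2.headI :: b.2), ?_, fun O v w hw => ?_⟩
  · refine h.1.bind (Partrec.map (h'.1.comp .fst) ?_)
    have p1 : Primrec fun x : (List ℕ × ℕ × List ℕ) × ℕ × List ℕ =>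
        (x.1.2.1 + 1 + 1 + x.2.1 + 1, x.1.2.2.headI :: x.2.2) :=
      (Primrec.succ.comp (Primrec.nat_add.comp (Primrec.succ.comp (Primrec.succ.comp
        (Primrec.fst.comp (Primrec.snd.comp Primrec.fst)))) (Primrec.fst.comp Primrec.snd))).pair
      (Primrec.list_cons.comp (Primrec.list_headI.comp
        (Primrec.snd.comp (Primrec.snd.comp Primrec.fst))) (Primrec.snd.comp Primrec.snd))
    exact p1.to_comp
  · simp only [Turing.ToPartrec.Code.cons_eval, Part.bind_eq_bind, Part.mem_bind_iff] at hw
    obtain ⟨a, ha, b, hb, hw⟩ := hw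
    obtain ⟨t, ht, hr⟩ := h.2 O v a ha
    obtain ⟨t', ht', hr'⟩ := h'.2 O v b hb
    obtain rfl := Part.mem_some_iff.1 hw
    refine ⟨_, Part.mem_bind ht (Part.mem_map _ ht'), .cons (.comp hr ?_) hr'⟩
    simpa only [Data.hd_nums] using Runs.hd (O := O) (Data.nums a)

theorem Simulates.comp {p p' : Prog} {g g' : List ℕ →. ℕ × List ℕ} {c c' : Code}
    (h : Simulates p g c) (h' : Simulates p' g' c') : ∃ p g, Simulates p g (.comp c c') := by
  refine ⟨.comp p p', fun v => (g' v).bind fun a => (g a.2).map fun b =>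
    (a.1 + b.1 + 1, b.2), ?_, fun O v w hw => ?_⟩
  · refine h'.1.bind (Partrec.map (h.1.comp (Computable.snd.comp .snd)) ?_)
    have p1 : Primrec fun x : (List ℕ × ℕ × List ℕ) × ℕ × List ℕ =>
        (x.1.2.1 + x.2.1 + 1, x.2.2) :=
      (Primrec.succ.comp (Primrec.nat_add.comp
        (Primrec.fst.comp (Primrec.snd.comp Primrec.fst)) (Primrec.fst.comp Primrec.snd))).pair
      (Primrec.snd.comp Primrec.snd)
    exact p1.to_comp
  · rw [Turing.ToPartrec.Code.comp_eval] at hw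
    obtain ⟨a, ha, hw⟩ := Part.mem_bind_iff.1 hw
    obtain ⟨t, ht, hr⟩ := h'.2 O v a ha
    obtain ⟨t', ht', hr'⟩ := h.2 O a w hw
    exact ⟨_, Part.mem_bind ht (Part.mem_map _ ht'), .comp hr hr'⟩

theorem Simulates.case {p p' : Prog} {g g' : List ℕ →. ℕ × List ℕ} {c c' : Code}
    (h : Simulates p g c) (h' : Simulates p' g' c') : ∃ p g, Simulates p g (.case c c') := by
  -- For a unary head, its tail is the predecessor.
  refine ⟨.cond .hd (.comp p' (.cons (.comp .tl .hd) .tl)) (.comp p .tl),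
    fun v => cond (decide (v.headI = 0)) ((g v.tail).map fun a => (1 + (1 + a.1 + 1) + 1, a.2))
      ((g' ((v.headI - 1) :: v.tail)).map fun a =>
        (1 + (1 + 1 + 1 + 1 + 1 + a.1 + 1) + 1, a.2)), ?_, fun O v w hw => ?_⟩
  · have hshift : ∀ m n : ℕ, Computable₂ fun (_ : List ℕ) (a : ℕ × List ℕ) =>
        (1 + (m + a.1 + 1) + n, a.2) := fun m n => by
      have p1 : Primrec fun x : List ℕ × ℕ × List ℕ => (1 + (m + x.2.1 + 1) + n, x.2.2) :=
        (Primrec.nat_add.comp (Primrec.nat_add.comp (Primrec.const 1) (Primrec.succ.comp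
          (Primrec.nat_add.comp (Primrec.const m) (Primrec.fst.comp Primrec.snd))))
          (Primrec.const n)).pair (Primrec.snd.comp Primrec.snd)
      exact p1.to_comp
    refine Partrec.cond ?_ (Partrec.map (h.1.comp Primrec.list_tail.to_comp) (hshift 1 1))
      (Partrec.map (h'.1.comp ?_) (hshift _ 1))
    · exact (Primrec.eq.decide.comp Primrec.list_headI (Primrec.const 0)).to_comp
    · exact (Primrec.list_cons.comp (Primrec.nat_sub.comp Primrec.list_headI (Primrec.const 1))
        Primrec.list_tail).to_comp
  · simp only [Turing.ToPartrec.Code.case_eval] at hw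
    have hhd := Runs.hd (O := O) (Data.nums v)
    have htl := Runs.tl (O := O) (Data.nums v)
    rw [Data.hd_nums] at hhd
    rw [Data.tl_nums] at htl
    rcases hv : v.headI with _ | y
    · rw [hv] at hw hhd
      obtain ⟨t, ht, hr⟩ := h.2 O _ w hw
      refine ⟨_, ?_, .cond_false hhd (.comp htl hr)⟩
      simpa only [hv, decide_true, cond_true] using
        Part.mem_map (fun a : ℕ × List ℕ => (1 + (1 + a.1 + 1) + 1, a.2)) ht
    · rw [hv] at hw hhd
      obtain ⟨t, ht, hr⟩ := h'.2 O _ w hw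
      refine ⟨_, ?_, .cond_true hhd (by simp [Data.num_succ])
        (.comp (.cons (.comp hhd (.tl _)) htl) hr)⟩
      simpa only [hv, Nat.add_one_ne_zero, decide_false, cond_false, Nat.add_sub_cancel] using
        Part.mem_map (fun a : ℕ × List ℕ => (1 + (1 + 1 + 1 + 1 + 1 + a.1 + 1) + 1, a.2)) ht

/-- The body leaves its continuation flag at the head of the list, where the loop tests it. So the
body runs once before the loop, each round first drops the flag, and a final tail removes the last
one. -/
theorem Simulates.fix {p : Prog} {g : List ℕ →. ℕ × List ℕ} {c : Code}
    (h : Simulates p g c) : ∃ p g, Simulates p g (.fix c) := by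
  -- One round, with the steps so far as first component. Beyond the body, the last round costs 2
  -- steps (test, exit) and any other round 4 (test, tail, composition, loop).
  let F : ℕ × List ℕ →. (ℕ × List ℕ) ⊕ (ℕ × List ℕ) := fun x => (g x.2).map fun a =>
    cond (decide (a.2.headI = 0)) (Sum.inl (x.1 + a.1 + 2, a.2.tail))
      (Sum.inr (x.1 + a.1 + 4, a.2.tail))
  have hF : Partrec F := by
    refine Partrec.map (h.1.comp .snd) ?_
    have hs : ∀ n : ℕ, Primrec fun x : (ℕ × List ℕ) × ℕ × List ℕ =>
        (x.1.1 + x.2.1 + n, x.2.2.tail) := fun n =>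
      (Primrec.nat_add.comp (Primrec.nat_add.comp (Primrec.fst.comp Primrec.fst)
        (Primrec.fst.comp Primrec.snd)) (Primrec.const n)).pair
        (Primrec.list_tail.comp (Primrec.snd.comp Primrec.snd))
    have hd : Primrec fun x : (ℕ × List ℕ) × ℕ × List ℕ => decide (x.2.2.headI = 0) :=
      Primrec.eq.decide.comp (Primrec.list_headI.comp (Primrec.snd.comp Primrec.snd))
        (Primrec.const 0)
    have p1 : Primrec fun x : (ℕ × List ℕ) × ℕ × List ℕ => cond (decide (x.2.2.headI = 0))
        (Sum.inl (β := ℕ × List ℕ) (x.1.1 + x.2.1 + 2, x.2.2.tail))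
        (Sum.inr (x.1.1 + x.2.1 + 4, x.2.2.tail)) :=
      Primrec.cond hd (Primrec.sumInl.comp (hs 2)) (Primrec.sumInr.comp (hs 4))
    exact p1.to_comp
  refine ⟨.comp .tl (.comp (.loop .hd (.comp p .tl)) p),
    fun v => (PFun.fix F (0, v)).map fun a => (a.1 + 1 + 1 + 1, a.2), ?_, fun O v w hw => ?_⟩
  · refine Partrec.map (hF.fix.comp ((Computable.const 0).pair .id)) ?_
    have p1 : Primrec fun x : List ℕ × ℕ × List ℕ => (x.2.1 + 1 + 1 + 1, x.2.2) :=
      (Primrec.succ.comp (Primrec.succ.comp (Primrec.succ.comp (Primrec.fst.comp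
        Primrec.snd)))).pair (Primrec.snd.comp Primrec.snd)
    exact p1.to_comp
  · rw [Turing.ToPartrec.Code.fix_eval] at hw
    -- The first run of the body is separated from the loop, so that the induction can prepend a
    -- round. The initial count t is arbitrary because it grows from round to round.
    have key : ∃ x y s r, Runs O p (Data.nums v) x s ∧ Runs O (.loop .hd (.comp p .tl)) x y r ∧
        y.tl = Data.nums w ∧ ∀ t, (t + s + r, w) ∈ PFun.fix F (t, v) := by
      refine PFun.fixInduction' (C := fun v => ∃ x y s r, Runs O p (Data.nums v) x s ∧
        Runs O (.loop .hd (.comp p .tl)) x y r ∧ y.tl = Data.nums w ∧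
        ∀ t, (t + s + r, w) ∈ PFun.fix F (t, v)) hw (fun u hu => ?_) (fun u u' _ hu ih => ?_)
      · obtain ⟨a, ha, hau⟩ := (Part.mem_map_iff _).1 hu
        obtain ⟨t, ht, hr⟩ := h.2 O u a ha
        split_ifs at hau with h0
        obtain rfl := Sum.inl_injective hau
        have hhd := Runs.hd (O := O) (Data.nums a)
        rw [Data.hd_nums, h0] at hhd
        refine ⟨_, _, t, 2, hr, .loop_done hhd, Data.tl_nums _, fun t' => PFun.fix_stop ?_⟩
        refine (Part.mem_map_iff _).2 ⟨_, ht, ?_⟩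
        simp [h0]
      · obtain ⟨a, ha, hau⟩ := (Part.mem_map_iff _).1 hu
        obtain ⟨t, ht, hr⟩ := h.2 O u a ha
        split_ifs at hau with h0
        obtain rfl := Sum.inr_injective hau
        obtain ⟨x, y, s, r, hx, hy, hyw, hfix⟩ := ih
        have hhd := Runs.hd (O := O) (Data.nums a)
        have htl := Runs.tl (O := O) (Data.nums a)
        rw [Data.hd_nums] at hhd
        rw [Data.tl_nums] at htl
        refine ⟨_, _, t, s + r + 4, hr, ?_, hyw, fun t' => ?_⟩
        · have := Runs.loop_step hhd (by rwa [Ne, Data.num_eq_nil]) (.comp htl hx) hy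
          rwa [show 1 + (1 + s + 1) + r + 1 = s + r + 4 by ring] at this
        · have hmem : Sum.inr (t' + t + 4, a.tail) ∈ F (t', u) :=
            (Part.mem_map_iff _).2 ⟨_, ht, by simp [h0]⟩
          rw [PFun.fix_fwd_eq hmem]
          have := hfix (t' + t + 4)
          rwa [show t' + t + 4 + s + r = t' + t + (s + r + 4) by ring] at this
    obtain ⟨x, y, s, r, hx, hy, hyw, hfix⟩ := key
    refine ⟨_, Part.mem_map _ (hfix 0), ?_⟩
    have := Runs.comp (.comp hx hy) (.tl y)
    rw [hyw] at this
    simpa using this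

theorem exists_simulates (c : Code) : ∃ p g, Simulates p g c := by
  induction c with
  | zero' =>
    exact Simulates.total (p := .cons .nil .id) (f := fun v => 0 :: v)
      (Primrec.list_cons.comp (Primrec.const 0) .id).to_comp (by simp)
      fun O v => .cons (.nil _) (.id _)
  | succ =>
    refine Simulates.total (p := .cons (.cons .nil .hd) .nil) (f := fun v => [v.headI.succ])
      (T := 5) (Primrec.list_cons.comp (Primrec.succ.comp Primrec.list_headI)
        (Primrec.const [])).to_comp (by simp) fun O v => ?_
    have := Runs.hd (O := O) (Data.nums v)
    rw [Data.hd_nums] at this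
    exact .cons (.cons (.nil _) this) (.nil _)
  | tail =>
    refine Simulates.total (p := .tl) (f := fun v => v.tail) (T := 1)
      Primrec.list_tail.to_comp (by simp) fun O v => ?_
    rw [← Data.tl_nums]
    exact .tl _
  | cons f g hf hg =>
    obtain ⟨p, t, h⟩ := hf
    obtain ⟨p', t', h'⟩ := hg
    exact h.cons h'
  | comp f g hf hg =>
    obtain ⟨p, t, h⟩ := hf
    obtain ⟨p', t', h'⟩ := hg
    exact h.comp h'
  | case f g hf hg =>
    obtain ⟨p, t, h⟩ := hf
    obtain ⟨p', t', h'⟩ := hg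
    exact h.case h'
  | fix f hf =>
    obtain ⟨p, t, h⟩ := hf
    exact h.fix

/-- Every computable function has a program with a computable running time. -/
theorem exists_prog_of_computable {f : ℕ → ℕ} (hf : Computable f) :
    ∃ (p : Prog) (T : ℕ → ℕ), Computable T ∧
      ∀ O n, ∃ t ≤ T n, Runs O p (Data.num n) (Data.num (f n)) t := by
  obtain ⟨c, hc⟩ := Turing.ToPartrec.Code.exists_code (Nat.Partrec'.part_iff₁.2 hf.partrec)
  obtain ⟨p, g, hg, h⟩ := exists_simulates c
  have hev : ∀ n, [f n] ∈ c.eval [n] := fun n => by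
    have := hc ⟨[n], rfl⟩
    rw [show (⟨[n], rfl⟩ : List.Vector ℕ 1).1 = [n] from rfl] at this
    rw [this]
    simp [List.Vector.head]
  have hT : ∀ n, ∃ t, (t, [f n]) ∈ g [n] := fun n => by
    obtain ⟨t, ht, -⟩ := h ∅ _ _ (hev n)
    exact ⟨t, ht⟩
  choose T hT using hT
  -- A partial recursive function with a value at every argument is computable; this applies to the
  -- step count.
  have hcomp : Computable fun n => (T n, [f n]) :=
    Partrec.of_eq_tot (hg.comp (Primrec.list_cons.comp .id (Primrec.const [])).to_comp) hT
  refine ⟨.comp .hd (.comp p (.cons .id .nil)), fun n => T n + 6,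
    Primrec.nat_add.to_comp.comp (Computable.fst.comp hcomp) (.const 6), fun O n => ?_⟩
  obtain ⟨t, ht, hr⟩ := h O _ _ (hev n)
  have htT : t = T n := congrArg Prod.fst (Part.mem_unique ht (hT n))
  refine ⟨_, ?_, .comp (.comp (.cons (.id _) (.nil _)) hr) (.hd _)⟩
  rw [htT]
  beta_reduce
  omega

namespace Ctx

variable {ι : Type} {Γ : Ctx ι}

theorem EvalNat.computable {f : ℕ → ℕ} (hf : Computable f) (hk : Γ.EvalNat Γ.par) :
    Γ.EvalNat (fun i => f (Γ.par i)) := by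
  obtain ⟨p, T, hT, h⟩ := exists_prog_of_computable hf
  exact Evaluates.comp hk ⟨p, fun i => T (Γ.par i), .par hT, fun i => h _ _⟩

end Ctx
-- The 2-CSP instances of a sketch: completeness and soundness
/-- The digit with index `p` of `a` in base `B`. -/
def digit (B a p : ℕ) : ℕ := a / B ^ p % B

theorem exists_digits {B : ℕ} (c : ℕ → ℕ) (s : ℕ) (hc : ∀ p < s, c p < B) :
    ∃ a < B ^ s, ∀ p < s, digit B a p = c p := by
  induction s generalizing c with
  | zero => exact ⟨0, by simp, by simp⟩
  | succ s ih =>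
    obtain ⟨a, ha, hd⟩ := ih (fun p => c (p + 1)) fun p hp => hc _ (by omega)
    have h0 := hc 0 (by omega)
    have hB : 0 < B := by omega
    refine ⟨c 0 + B * a, ?_, fun p hp => ?_⟩
    · calc c 0 + B * a < B + B * a := by omega
        _ = B * (a + 1) := by ring
        _ ≤ B * B ^ s := Nat.mul_le_mul_left _ ha
        _ = B ^ (s + 1) := by ring
    · cases p with
      | zero => simp [digit, Nat.mod_eq_of_lt h0]
      | succ p =>
        have := hd p (by omega)
        rw [digit, pow_succ', ← Nat.div_div_eq_div_mul, Nat.add_mul_div_left _ _ hB,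
          Nat.div_eq_of_lt h0, zero_add]
        exact this

/-- The data from which 2-CSP instances are built: `l` blocks of `s` sampled elements each, `M` sets
of which `k` are to be chosen, labels below `B`, the precision `D` and the threshold `θ`; `hit b q`
tells whether the set `b` contains the sampled element `q`. -/
structure Sketch where
  l : ℕ
  k : ℕ
  s : ℕ
  D : ℕ
  θ : ℕ
  M : ℕ
  B : ℕ
  hit : ℕ → ℕ → Bool

namespace Sketch

/-- The guess, encoded in `G`, of how many elements of the block `j` are assigned to the set with
index `i`, in multiples of `s / D`. -/
def guess (X : Sketch) (G j i : ℕ) : ℕ := digit (X.D + 1) G (j * X.k + i)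

/-- This is the total edge weight of the instance. The summand 1 compensates for rounding a count
down. -/
def guessSum (X : Sketch) (G : ℕ) : ℕ :=
  ∑ j ∈ Finset.range X.l, ∑ i ∈ Finset.range X.k, (X.guess G j i + 1)

/-- The number of elements of the block `j` that the labelling `a` assigns to the index `i` and that
the set `b` contains. -/
def blockCount (X : Sketch) (a b j i : ℕ) : ℕ :=
  Nat.count (fun p => (decide (digit X.B a p = i + 1) && X.hit b (j * X.s + p)) = true) X.s

/-- The first test is the same for all edges and assignments: it invalidates tables whose total is
too small. The second compares the count with the guess times s/D, without division. -/
def relVal (X : Sketch) (G j i a b : ℕ) : Bool :=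
  decide (X.θ ≤ X.guessSum G) && decide (X.guess G j i * X.s ≤ X.D * X.blockCount a b j i)

theorem sum_edges (l k : ℕ) {R : Type*} [AddCommMonoid R] (f : ℕ → ℕ → R) :
    ∑ u : Fin (l + k), ∑ v : Fin (l + k), (if (u : ℕ) < l ∧ l ≤ (v : ℕ) then f u v else 0) =
      ∑ j ∈ Finset.range l, ∑ i ∈ Finset.range k, f j (l + i) := by
  have h1 : ∀ u : ℕ, (∑ v : Fin (l + k), if u < l ∧ l ≤ (v : ℕ) then f u v else 0) =
      ∑ v ∈ Finset.range (l + k), if u < l ∧ l ≤ v then f u v else 0 := fun u =>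
    Fin.sum_univ_eq_sum_range (fun v => if u < l ∧ l ≤ v then f u v else 0) (l + k)
  rw [Finset.sum_congr rfl fun (u : Fin (l + k)) _ => h1 u, Fin.sum_univ_eq_sum_range
    (fun u => ∑ v ∈ Finset.range (l + k), if u < l ∧ l ≤ v then f u v else 0) (l + k),
    Finset.sum_range_add, Finset.sum_eq_zero (s := Finset.range k) (by simp), add_zero]
  refine Finset.sum_congr rfl fun j hj => ?_
  rw [Finset.mem_range] at hj
  rw [Finset.sum_range_add, Finset.sum_eq_zero (s := Finset.range l), zero_add]
  · simp [hj]
  · intro v hv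
    rw [Finset.mem_range] at hv
    simp [hv]

theorem sum_weights_pos (l k : ℕ) (hl : 0 < l) (hk : 0 < k) (g : ℕ → ℕ → ℕ) :
    0 < ∑ j ∈ Finset.range l, ∑ i ∈ Finset.range k, (g j i + 1) :=
  Finset.sum_pos (fun _ _ => Finset.sum_pos (fun _ _ => Nat.succ_pos _) (by simpa using hk.ne'))
    (by simpa using hl.ne')

/-- The labels of the blocks are the first `l` variables, the chosen sets are the other `k`. -/
def csp (X : Sketch) (hl : 0 < X.l) (hk : 0 < X.k) (hM : 0 < X.M) (hB : 0 < X.B) (G : ℕ) : CSP where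
  n := X.l + X.k
  alph := fun v => if (v : ℕ) < X.l then X.B ^ X.s else X.M
  alph_pos := fun v => by split_ifs <;> positivity
  edge := fun u v => decide ((u : ℕ) < X.l ∧ X.l ≤ (v : ℕ))
  edge_lt := fun u v h => by
    rw [decide_eq_true_iff] at h
    exact Fin.lt_def.2 (by omega)
  weight := fun u v => X.guess G u (v - X.l) + 1
  rel := fun u v a b => X.relVal G u (v - X.l) a b
  weight_pos := by
    simp only [decide_eq_true_iff]
    rw [sum_edges X.l X.k (fun u v => X.guess G u (v - X.l) + 1)]
    exact sum_weights_pos _ _ hl hk _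

variable (X : Sketch) (hl : 0 < X.l) (hk : 0 < X.k) (hM : 0 < X.M) (hB : 0 < X.B)

/-- Guess the true label counts, rounded down to multiples of s/D. The constraints ask for no more
than the rounded counts, whereas a guess plus one exceeds the true count in these units, so the
total weight reaches θ. -/
theorem exists_satisfiable (hs : 0 < X.s) (x : ℕ → ℕ) (hx : ∀ i < X.k, x i < X.M) (lab : ℕ → ℕ)
    (hlab : ∀ q, lab q < X.B) (hlab' : ∀ q i, lab q = i + 1 → i < X.k ∧ X.hit (x i) q = true)
    (hθ : X.θ * X.s ≤ X.D * ∑ j ∈ Finset.range X.l,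
      ((Finset.range X.s).filter fun p => lab (j * X.s + p) ≠ 0).card) :
    ∃ G < (X.D + 1) ^ (X.k * X.l), (X.csp hl hk hM hB G).Satisfiable := by
  set c : ℕ → ℕ → ℕ := fun j i =>
    ((Finset.range X.s).filter fun p => lab (j * X.s + p) = i + 1).card with hc
  have hcs : ∀ j i, c j i ≤ X.s := fun j i =>
    (Finset.card_filter_le _ _).trans (by simp)
  -- The digit m belongs to the block m / k and the index m % k. It is at most D because a count is
  -- at most s.
  obtain ⟨G, hG, hGd⟩ := exists_digits (B := X.D + 1)
    (fun m => X.D * c (m / X.k) (m % X.k) / X.s) (X.k * X.l) fun m _ => by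
      rw [Nat.lt_succ_iff]
      exact Nat.div_le_of_le_mul (by rw [mul_comm X.s]; exact Nat.mul_le_mul_left _ (hcs _ _))
  have hguess : ∀ j < X.l, ∀ i < X.k, X.guess G j i = X.D * c j i / X.s := fun j hj i hi => by
    have hlt : j * X.k + i < X.k * X.l := by nlinarith
    rw [guess, hGd _ hlt]
    have e1 : (j * X.k + i) / X.k = j := by
      rw [mul_comm, Nat.mul_add_div hk, Nat.div_eq_of_lt hi, add_zero]
    have e2 : (j * X.k + i) % X.k = i := by
      rw [mul_comm, Nat.mul_add_mod, Nat.mod_eq_of_lt hi]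
    rw [e1, e2]
  have hcsum : ∀ j, ((Finset.range X.s).filter fun p => lab (j * X.s + p) ≠ 0).card =
      ∑ i ∈ Finset.range X.k, c j i := fun j => by
    rw [Finset.card_eq_sum_card_fiberwise (f := fun p => lab (j * X.s + p) - 1)
      (t := Finset.range X.k)]
    · refine Finset.sum_congr rfl fun i _ => ?_
      rw [hc, Finset.filter_filter]
      congr 1
      refine Finset.filter_congr fun p _ => ?_
      omega
    · intro p hp
      simp only [Finset.coe_filter, Set.mem_ofPred_eq] at hp
      obtain ⟨i, hi⟩ := Nat.exists_eq_succ_of_ne_zero hp.2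
      have := (hlab' _ _ hi).1
      simp only [Finset.coe_range, Set.mem_Iio]
      omega
  have hsum : X.θ ≤ X.guessSum G := by
    refine Nat.le_of_mul_le_mul_right (hθ.trans ?_) hs
    rw [guessSum, Finset.mul_sum, Finset.sum_mul]
    refine Finset.sum_le_sum fun j hj => ?_
    rw [hcsum, Finset.mul_sum, Finset.sum_mul]
    refine Finset.sum_le_sum fun i hi => ?_
    rw [hguess j (Finset.mem_range.1 hj) i (Finset.mem_range.1 hi)]
    -- The rounding step: D c < (⌊D c / s⌋ + 1) s.
    exact (Nat.lt_div_mul_add hs).le.trans (by rw [add_mul, one_mul])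
  have ha : ∀ j, ∃ a < X.B ^ X.s, ∀ p < X.s, digit X.B a p = lab (j * X.s + p) := fun j =>
    exists_digits _ _ fun _ _ => hlab _
  choose a ha had using ha
  refine ⟨G, hG, fun v => if h : (v : ℕ) < X.l then ⟨a v, ?_⟩ else ⟨x (v - X.l), ?_⟩,
    fun u v huv => ?_⟩
  · simpa [csp, h] using ha _
  · have := v.2
    simp only [csp] at this h ⊢
    rw [if_neg h]
    exact hx _ (by omega)
  · have hu : (u : ℕ) < X.l ∧ X.l ≤ (v : ℕ) := by simpa [csp] using huv
    have hv : (v : ℕ) - X.l < X.k := by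
      have := v.2
      simp only [csp] at this
      omega
    simp only [csp, relVal, hu.1, not_lt.2 hu.2, dite_true, dite_false, Bool.and_eq_true,
      decide_eq_true_iff]
    refine ⟨hsum, ?_⟩
    rw [hguess _ hu.1 _ hv]
    refine (Nat.div_mul_le_self _ _).trans (Nat.mul_le_mul_left _ ?_)
    rw [blockCount, Nat.count_eq_card_filter_range]
    refine Finset.card_le_card fun p hp => ?_
    rw [Finset.mem_filter] at hp ⊢
    rw [Bool.and_eq_true, decide_eq_true_iff, had _ _ (Finset.mem_range.1 hp.1)]
    exact ⟨hp.1, hp.2, (hlab' _ _ hp.2).2⟩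

/-- Whatever the labelling, an element has only one label, so the elements counted for different
indices are disjoint. -/
theorem sum_blockCount_le (a j : ℕ) (x : ℕ → ℕ) :
    ∑ i ∈ Finset.range X.k, X.blockCount a (x i) j i ≤
      ((Finset.range X.s).filter fun p => ∃ i < X.k, X.hit (x i) (j * X.s + p) = true).card := by
  have hdisj : Set.PairwiseDisjoint (Finset.range X.k : Set ℕ) fun i =>
      (Finset.range X.s).filter fun p =>
        (decide (digit X.B a p = i + 1) && X.hit (x i) (j * X.s + p)) = true := by
    intro i _ i' _ hne
    rw [Function.onFun, Finset.disjoint_left]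
    intro p hp hp'
    simp only [Finset.mem_filter, Bool.and_eq_true, decide_eq_true_iff] at hp hp'
    omega
  simp only [blockCount, Nat.count_eq_card_filter_range]
  rw [← Finset.card_biUnion hdisj]
  refine Finset.card_le_card fun p hp => ?_
  simp only [Finset.mem_biUnion, Finset.mem_filter, Bool.and_eq_true] at hp
  obtain ⟨i, hi, hp, -, hh⟩ := hp
  exact Finset.mem_filter.2 ⟨hp, i, Finset.mem_range.1 hi, hh⟩

/-- A satisfied edge has (guess + 1) s ≤ D · count + s. In the sum over all edges, the counts are
bounded by the covered part of the sample and the last terms by k l s; the total weight in the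
denominator is at least θ. -/
theorem valueAtMost (hs : 0 < X.s) {σ : ℝ} (hσ : 0 ≤ σ)
    (h : ∀ x : ℕ → ℕ, (∀ i < X.k, x i < X.M) →
      (X.D : ℝ) * ((∑ j ∈ Finset.range X.l, ((Finset.range X.s).filter fun p =>
        ∃ i < X.k, X.hit (x i) (j * X.s + p) = true).card : ℕ) : ℝ) + X.k * X.l * X.s ≤
        σ * X.θ * X.s) (G : ℕ) : (X.csp hl hk hM hB G).ValueAtMost σ := by
  intro ψ
  have hn : (X.csp hl hk hM hB G).n = X.l + X.k := rfl
  set y : ℕ → ℕ := fun u => if h : u < X.l + X.k then (ψ ⟨u, h⟩ : ℕ) else 0 with hy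
  have hyψ : ∀ u : Fin (X.csp hl hk hM hB G).n, (ψ u : ℕ) = y u := fun u => by
    have : (u : ℕ) < X.l + X.k := u.2
    simp [hy, this]
  have hden : (∑ u, ∑ v, if (X.csp hl hk hM hB G).edge u v = true then
      ((X.csp hl hk hM hB G).weight u v : ℝ) else 0) = X.guessSum G := by
    have := sum_edges X.l X.k (fun u v => ((X.guess G u (v - X.l) + 1 : ℕ) : ℝ))
    refine (Eq.trans ?_ this).trans (by simp [guessSum])
    refine Finset.sum_congr rfl fun u _ => Finset.sum_congr rfl fun v _ => ?_
    simp only [csp, decide_eq_true_iff]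
  have hnum : (∑ u, ∑ v, if (X.csp hl hk hM hB G).edge u v = true ∧
      (X.csp hl hk hM hB G).rel u v (ψ u) (ψ v) = true then
      ((X.csp hl hk hM hB G).weight u v : ℝ) else 0) =
      ((∑ j ∈ Finset.range X.l, ∑ i ∈ Finset.range X.k,
        if X.relVal G j i (y j) (y (X.l + i)) = true then X.guess G j i + 1 else 0 : ℕ) : ℝ) := by
    have := sum_edges X.l X.k (fun u v => if X.relVal G u (v - X.l) (y u) (y v) = true then
      ((X.guess G u (v - X.l) + 1 : ℕ) : ℝ) else 0)
    simp only [Nat.add_sub_cancel_left] at this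
    push_cast at this ⊢
    refine Eq.trans ?_ this
    refine Finset.sum_congr rfl fun u _ => Finset.sum_congr rfl fun v _ => ?_
    rw [ite_and]
    simp only [csp, decide_eq_true_iff, hyψ, Nat.cast_add, Nat.cast_one]
  rw [CSP.val, hden, hnum]
  have hpos : 0 < X.guessSum G := sum_weights_pos _ _ hl hk _
  rw [div_le_iff₀ (by exact_mod_cast hpos)]
  -- If the total is below θ, no constraint is satisfied and the value is 0.
  by_cases hθ : X.θ ≤ X.guessSum G
  swap
  · simp only [relVal, hθ, decide_false, Bool.false_and, Bool.false_eq_true, if_false]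
    simpa using mul_nonneg hσ (Nat.cast_nonneg _)
  have hM' : ∀ i < X.k, y (X.l + i) < X.M := fun i hi => by
    have h1 : X.l + i < (X.csp hl hk hM hB G).n := by rw [hn]; omega
    refine (hyψ ⟨X.l + i, h1⟩).symm.trans_lt ((ψ ⟨X.l + i, h1⟩).2.trans_eq ?_)
    simp [csp]
  have hx := h (fun i => y (X.l + i)) hM'
  have key : (∑ j ∈ Finset.range X.l, ∑ i ∈ Finset.range X.k,
      if X.relVal G j i (y j) (y (X.l + i)) = true then X.guess G j i + 1 else 0) * X.s ≤
      X.D * (∑ j ∈ Finset.range X.l, ((Finset.range X.s).filter fun p =>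
        ∃ i < X.k, X.hit (y (X.l + i)) (j * X.s + p) = true).card) + X.k * X.l * X.s := by
    calc _ ≤ ∑ j ∈ Finset.range X.l, ∑ i ∈ Finset.range X.k,
          (X.D * X.blockCount (y j) (y (X.l + i)) j i + X.s) := by
          rw [Finset.sum_mul]
          refine Finset.sum_le_sum fun j _ => ?_
          rw [Finset.sum_mul]
          refine Finset.sum_le_sum fun i _ => ?_
          split_ifs with hr
          · simp only [relVal, Bool.and_eq_true, decide_eq_true_iff] at hr
            nlinarith [hr.2]
          · simp
      _ = X.D * (∑ j ∈ Finset.range X.l, ∑ i ∈ Finset.range X.k,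
          X.blockCount (y j) (y (X.l + i)) j i) + X.k * X.l * X.s := by
          simp only [Finset.sum_add_distrib, Finset.mul_sum, Finset.sum_const, Finset.card_range,
            smul_eq_mul]
          ring
      _ ≤ _ := by
          gcongr with j _
          exact X.sum_blockCount_le _ _ (fun i => y (X.l + i))
  have hs' : (0 : ℝ) < X.s := by exact_mod_cast hs
  refine le_of_mul_le_mul_right (?_ : _ * (X.s : ℝ) ≤ _) hs'
  refine (by exact_mod_cast key : _ ≤ _).trans (hx.trans ?_)
  have : (X.θ : ℝ) ≤ X.guessSum G := by exact_mod_cast hθ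
  gcongr

end Sketch

/-! ### Chernoff bound and sampling with random bits -/

open Finset in
/-- The Chernoff bound for the uniform distribution on the sequences of length `m`. -/
theorem card_large_count_le {W : Type*} [Fintype W] (A : W → Prop) [DecidablePred A] (m : ℕ)
    {ρ ε : ℝ} (hε : 0 < ε) (hε1 : ε ≤ 1) (hρ1 : ρ ≤ 1) (hρ0 : 0 ≤ ρ)
    (hρ : (#{w | A w} : ℝ) ≤ ρ * Fintype.card W) :
    (#{f : Fin m → W | (ρ + ε) * m ≤ (#{p | A (f p)} : ℝ)} : ℝ) ≤
      Real.exp (-(ε ^ 2 * m / 4)) * (Fintype.card W : ℝ) ^ m := by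
  -- With e^s ≤ 1 + s + s², the exponent per draw becomes s² - sε, which is minimal, namely -ε²/4,
  -- at s = ε/2.
  set s : ℝ := ε / 2 with hs
  have hs0 : 0 < s := by positivity
  set g : W → ℝ := fun w => if A w then Real.exp s else 1 with hg
  have hexp : Real.exp s ≤ 1 + s + s ^ 2 := by
    have := Real.abs_exp_sub_one_sub_id_le (x := s) (by rw [abs_of_pos hs0]; linarith)
    have := (abs_le.1 this).2
    linarith
  have hsum : ∑ w, g w ≤ Fintype.card W * Real.exp (s * ρ + s ^ 2) := by
    calc ∑ w, g w = ∑ w, (1 + if A w then Real.exp s - 1 else 0) := by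
          refine sum_congr rfl fun w _ => ?_
          simp only [hg]
          split_ifs <;> ring
      _ = Fintype.card W + #{w | A w} * (Real.exp s - 1) := by
          rw [sum_add_distrib, ← sum_filter, sum_const, sum_const, card_univ, nsmul_eq_mul,
            nsmul_eq_mul, mul_one]
      _ ≤ Fintype.card W + ρ * Fintype.card W * (s + s ^ 2) := by
          have h1 : 0 ≤ Real.exp s - 1 := by have := Real.add_one_le_exp s; linarith
          have h2 : Real.exp s - 1 ≤ s + s ^ 2 := by linarith
          gcongr
      _ ≤ Fintype.card W * (1 + (s * ρ + s ^ 2)) := by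
          have : (0 : ℝ) ≤ Fintype.card W := Nat.cast_nonneg _
          nlinarith [mul_nonneg this (mul_nonneg (sub_nonneg.2 hρ1) (sq_nonneg s))]
      _ ≤ _ := by
          gcongr
          linarith [Real.add_one_le_exp (s * ρ + s ^ 2)]
  have hprod : ∀ f : Fin m → W, ∏ p, g (f p) = Real.exp (s * #{p | A (f p)}) := fun f => by
    simp only [hg]
    rw [prod_ite, prod_const, prod_const_one, mul_one, ← Real.exp_nat_mul, mul_comm]
  have hg0 : ∀ w, 0 ≤ g w := fun w => by simp only [hg]; split_ifs <;> positivity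
  -- Markov's inequality for the exponential of s times the count; over all sequences this
  -- exponential sums to a power, by independence.
  have hmain : (#{f : Fin m → W | (ρ + ε) * m ≤ (#{p | A (f p)} : ℝ)} : ℝ) *
      Real.exp (s * ((ρ + ε) * m)) ≤
      (Fintype.card W : ℝ) ^ m * Real.exp (m * (s * ρ + s ^ 2)) := by
    calc _ = ∑ f ∈ ({f : Fin m → W | (ρ + ε) * m ≤ (#{p | A (f p)} : ℝ)} : Finset _),
          Real.exp (s * ((ρ + ε) * m)) := by rw [sum_const, nsmul_eq_mul]
      _ ≤ ∑ f ∈ ({f : Fin m → W | (ρ + ε) * m ≤ (#{p | A (f p)} : ℝ)} : Finset _),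
          ∏ p, g (f p) := by
          refine sum_le_sum fun f hf => ?_
          rw [hprod]
          have := (mem_filter.1 hf).2
          gcongr
      _ ≤ ∑ f : Fin m → W, ∏ p, g (f p) :=
          sum_le_sum_of_subset_of_nonneg (filter_subset _ _)
            fun f _ _ => prod_nonneg fun p _ => hg0 _
      _ = (∑ w, g w) ^ m := (Fintype.sum_pow g m).symm
      _ ≤ (Fintype.card W * Real.exp (s * ρ + s ^ 2)) ^ m := by
          gcongr
      _ = _ := by rw [mul_pow, ← Real.exp_nat_mul]
  rw [← le_div_iff₀ (Real.exp_pos _), mul_div_assoc, ← Real.exp_sub] at hmain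
  refine hmain.trans_eq ?_
  rw [mul_comm, show (m : ℝ) * (s * ρ + s ^ 2) - s * ((ρ + ε) * m) = -(ε ^ 2 * m / 4) by
    rw [hs]
    ring]

theorem count_mod_mul (A : ℕ → Prop) [DecidablePred A] (u d : ℕ) :
    Nat.count (fun y => A (y % u)) (u * d) = d * Nat.count A u := by
  induction d with
  | zero => simp
  | succ d ih =>
    rw [Nat.mul_succ, Nat.count_add, ih, add_mul, one_mul]
    congr 1
    rw [Nat.count_eq_card_filter_range, Nat.count_eq_card_filter_range]
    congr 1
    refine Finset.filter_congr fun y hy => ?_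
    rw [Nat.mul_add_mod, Nat.mod_eq_of_lt (Finset.mem_range.1 hy)]

/-- Complete periods have the exact density, and the incomplete one contributes at most u. -/
theorem count_mod_le (A : ℕ → Prop) [DecidablePred A] {u : ℕ} (hu : 0 < u) (n : ℕ) :
    (Nat.count (fun y => A (y % u)) n : ℝ) ≤ n * (Nat.count A u / u) + u := by
  have h1 : Nat.count (fun y => A (y % u)) n ≤ n / u * Nat.count A u + u := by
    conv_lhs => rw [← Nat.div_add_mod n u]
    rw [Nat.count_add, count_mod_mul]
    have := Nat.count_le (p := fun k => A ((u * (n / u) + k) % u)) (n := n % u)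
    have := (Nat.mod_lt n hu).le
    omega
  have hu' : (0 : ℝ) < u := by exact_mod_cast hu
  have h2 : ((n / u : ℕ) : ℝ) ≤ n / u := Nat.cast_div_le
  calc (Nat.count (fun y => A (y % u)) n : ℝ) ≤ (n / u : ℕ) * Nat.count A u + u := by
        exact_mod_cast h1
    _ ≤ n / u * Nat.count A u + u := by gcongr
    _ = _ := by ring

/-- The number with the binary digits `f`. -/
def bitsVal {b : ℕ} (f : Fin b → Bool) : ℕ := ∑ t : Fin b, if f t = true then 2 ^ (t : ℕ) else 0

open Finset in
theorem card_bitsVal (A : ℕ → Prop) [DecidablePred A] (b : ℕ) :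
    #{f : Fin b → Bool | A (bitsVal f)} = Nat.count A (2 ^ b) := by
  have he : ∃ e : (Fin b → Bool) ≃ Fin (2 ^ b), ∀ f, (e f : ℕ) = bitsVal f := by
    refine ⟨(Equiv.arrowCongr (Equiv.refl _) finTwoEquiv.symm).trans finFunctionFinEquiv,
      fun f => ?_⟩
    simp only [Equiv.trans_apply, finFunctionFinEquiv_apply, bitsVal]
    refine sum_congr rfl fun t _ => ?_
    simp only [Equiv.arrowCongr_apply, Function.comp, Equiv.refl_symm, Equiv.refl_apply]
    cases f t <;> simp [finTwoEquiv]
  obtain ⟨e, he⟩ := he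
  rw [Nat.count_eq_card_filter_range]
  refine card_bij (fun f _ => (e f : ℕ)) (fun f hf => ?_) (fun f _ f' _ h => ?_) fun y hy => ?_
  · rw [mem_filter] at hf ⊢
    rw [he]
    exact ⟨mem_range.2 (he f ▸ (e f).2), hf.2⟩
  · exact e.injective (Fin.ext h)
  · rw [mem_filter, mem_range] at hy
    refine ⟨e.symm ⟨y, hy.1⟩, ?_, by simp⟩
    simp [← he, hy.2]

/-- The bit with index `t`, or `false` if there are not so many bits. -/
def coin {R : ℕ} (r : Fin R → Bool) (t : ℕ) : Bool := if h : t < R then r ⟨t, h⟩ else false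

/-- The element of a universe of size `u` with index `q` in the sample; `b` bits are spent for each
element. -/
def sample (b u : ℕ) {R : ℕ} (r : Fin R → Bool) (q : ℕ) : ℕ :=
  (∑ t ∈ Finset.range b, if coin r (q * b + t) = true then 2 ^ t else 0) % u

theorem exists_equiv_blocks (m b c : ℕ) :
    ∃ e : (Fin (m * b + c) → Bool) ≃ (Fin m → Fin b → Bool) × (Fin c → Bool),
      ∀ r (p : Fin m) (t : Fin b), (e r).1 p t = coin r (p * b + t) := by
  refine ⟨((Fin.appendEquiv (m * b) c).symm).trans
    (Equiv.prodCongr ((Equiv.arrowCongr finProdFinEquiv.symm (Equiv.refl _)).trans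
      (Equiv.curry _ _ _)) (Equiv.refl _)), fun r p t => ?_⟩
  have hlt : (p : ℕ) * b + t < m * b + c := by
    have := p.2
    have := t.2
    nlinarith
  simp only [coin, hlt, dite_true]
  simp only [Fin.appendEquiv, Equiv.trans_apply, Equiv.coe_fn_symm_mk, Equiv.prodCongr_apply,
    Prod.map, Equiv.curry_apply, Function.curry, Equiv.arrowCongr_apply, Function.comp,
    Equiv.symm_symm, Equiv.refl_apply]
  congr 1
  ext
  simp [finProdFinEquiv]
  ring

open Finset in
-- The first m b bits form m independent words, and each of the c surplus bits is free.
theorem card_coins (m b c : ℕ) (P : (Fin m → Fin b → Bool) → Prop) [DecidablePred P] :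
    #{r : Fin (m * b + c) → Bool | P fun p t => coin r (p * b + t)} = #{f | P f} * 2 ^ c := by
  obtain ⟨e, he⟩ := exists_equiv_blocks m b c
  have h1 : ∀ r, (fun (p : Fin m) (t : Fin b) => coin r (p * b + t)) = (e r).1 := fun r => by
    funext p t
    rw [he]
  rw [show (2 : ℕ) ^ c = #(univ : Finset (Fin c → Bool)) by simp, ← card_product]
  refine card_equiv e fun r => ?_
  simp [h1]

open Finset in
-- Reduction modulo u of a uniform word of b bits changes a density by at most u/2^b ≤ ε; the
-- Chernoff bound allows for another ε.
theorem card_sample_large_le {u b m c : ℕ} (hu : 0 < u) (A : ℕ → Prop) [DecidablePred A] {ε : ℝ}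
    (hε : 0 < ε) (hε1 : ε ≤ 1) (hb : (u : ℝ) ≤ ε * 2 ^ b) :
    (#{r : Fin (m * b + c) → Bool |
      ((Nat.count A u : ℝ) / u + 2 * ε) * m ≤ (#{q ∈ range m | A (sample b u r q)} : ℝ)} : ℝ) ≤
      Real.exp (-(ε ^ 2 * m / 4)) * 2 ^ (m * b + c) := by
  have hu' : (0 : ℝ) < u := by exact_mod_cast hu
  have hsample : ∀ (r : Fin (m * b + c) → Bool) (p : Fin m),
      sample b u r p = bitsVal (fun t : Fin b => coin r (p * b + t)) % u := fun r p => by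
    rw [sample, bitsVal, Fin.sum_univ_eq_sum_range
      (fun t => if coin r (p * b + t) = true then 2 ^ t else 0)]
  have hcount : ∀ r : Fin (m * b + c) → Bool, #{q ∈ range m | A (sample b u r q)} =
      #{p : Fin m | A (bitsVal (fun t : Fin b => coin r (p * b + t)) % u)} := fun r => by
    simp_rw [← hsample]
    rw [card_filter, card_filter,
      ← Fin.sum_univ_eq_sum_range (fun q => if A (sample b u r q) then 1 else 0)]
  simp_rw [hcount]
  rw [card_coins m b c fun f =>
    ((Nat.count A u : ℝ) / u + 2 * ε) * m ≤ (#{p : Fin m | A (bitsVal (f p) % u)} : ℝ)]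
  have ha : (Nat.count A u : ℝ) / u ≤ 1 := by
    rw [div_le_one hu']
    exact_mod_cast (Nat.count_le _ : Nat.count A u ≤ u)
  have hpw : (0 : ℝ) < 2 ^ b := by positivity
  -- The cap is there because the Chernoff bound requires ρ ≤ 1.
  set ρ : ℝ := min 1 ((Nat.count A u : ℝ) / u + ε) with hρ
  have hle : (#{w : Fin b → Bool | A (bitsVal w % u)} : ℝ) ≤ ρ * Fintype.card (Fin b → Bool) := by
    rw [card_bitsVal (fun y => A (y % u)) b]
    simp only [Fintype.card_fun, Fintype.card_bool, Fintype.card_fin, Nat.cast_pow, Nat.cast_ofNat]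
    rw [hρ, min_mul_of_nonneg _ _ hpw.le, le_min_iff]
    constructor
    · rw [one_mul]
      exact_mod_cast (Nat.count_le _ : Nat.count (fun y => A (y % u)) (2 ^ b) ≤ 2 ^ b)
    · have := count_mod_le A hu (2 ^ b)
      push_cast at this
      linarith
  have := card_large_count_le (fun w : Fin b → Bool => A (bitsVal w % u)) m hε hε1
    (min_le_left _ _) (by positivity) hle
  have hmono : (#{f : Fin m → Fin b → Bool | ((Nat.count A u : ℝ) / u + 2 * ε) * m ≤
      (#{p : Fin m | A (bitsVal (f p) % u)} : ℝ)} : ℝ) ≤ #{f : Fin m → Fin b → Bool |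
        (ρ + ε) * m ≤ (#{p : Fin m | A (bitsVal (f p) % u)} : ℝ)} := by
    refine Nat.cast_le.2 (card_le_card fun f hf => ?_)
    rw [mem_filter] at hf ⊢
    refine ⟨hf.1, le_trans ?_ hf.2⟩
    have : ρ ≤ (Nat.count A u : ℝ) / u + ε := min_le_right _ _
    exact mul_le_mul_of_nonneg_right (by linarith) (Nat.cast_nonneg _)
  calc _ ≤ Real.exp (-(ε ^ 2 * m / 4)) * (Fintype.card (Fin b → Bool) : ℝ) ^ m * 2 ^ c := by
        push_cast
        gcongr
        exact hmono.trans this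
    _ = _ := by
        simp only [Fintype.card_fun, Fintype.card_bool, Fintype.card_fin]
        push_cast
        rw [← pow_mul, mul_comm b m, pow_add]
        ring

open Finset in
/-- With high probability, the sample has approximately the right density in each set of a family. -/
theorem coinProb_sample {u b m R : ℕ} (hu : 0 < u) {X : Type*} [Fintype X] (A : X → ℕ → Prop)
    [∀ x, DecidablePred (A x)] {ε : ℝ} (hε : 0 < ε) (hε1 : ε ≤ 1) (hb : (u : ℝ) ≤ ε * 2 ^ b)
    (hR : m * b ≤ R) :
    1 - 2 * Fintype.card X * Real.exp (-(ε ^ 2 * m / 4)) ≤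
      coinProb R {r | ∀ x, |(#{q ∈ range m | A x (sample b u r q)} : ℝ) -
        (Nat.count (A x) u : ℝ) / u * m| ≤ 2 * ε * m} := by
  classical
  obtain ⟨c, rfl⟩ := Nat.exists_eq_add_of_le hR
  have hu' : (0 : ℝ) < u := by exact_mod_cast hu
  set η := Real.exp (-(ε ^ 2 * m / 4))
  set up : X → Finset (Fin (m * b + c) → Bool) := fun x => {r |
    ((Nat.count (A x) u : ℝ) / u + 2 * ε) * m ≤ (#{q ∈ range m | A x (sample b u r q)} : ℝ)} with hup
  -- A deficit in a set is an excess in its complement, so the same tail bound applies.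
  set lo : X → Finset (Fin (m * b + c) → Bool) := fun x => {r |
    ((Nat.count (fun y => ¬ A x y) u : ℝ) / u + 2 * ε) * m ≤
      (#{q ∈ range m | ¬ A x (sample b u r q)} : ℝ)} with hlo
  set good : Finset (Fin (m * b + c) → Bool) := {r |
    ∀ x, |(#{q ∈ range m | A x (sample b u r q)} : ℝ) -
        (Nat.count (A x) u : ℝ) / u * m| ≤ 2 * ε * m} with hgood
  have hset : {r : Fin (m * b + c) → Bool | ∀ x, |(#{q ∈ range m | A x (sample b u r q)} : ℝ) -
        (Nat.count (A x) u : ℝ) / u * m| ≤ 2 * ε * m} = ↑good := by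
    ext r
    simp [hgood]
  rw [coinProb, hset, Set.ncard_coe_finset, le_div_iff₀ (by positivity)]
  have hcover : (univ : Finset (Fin (m * b + c) → Bool)) ⊆
      good ∪ univ.biUnion fun x => up x ∪ lo x := by
    intro r _
    by_contra hr
    simp only [mem_union, mem_biUnion, mem_univ, true_and, not_or, not_exists, hup, hlo, hgood,
      mem_filter, not_le, not_forall] at hr
    obtain ⟨⟨x, hx⟩, h⟩ := hr
    refine absurd hx (not_lt.2 (abs_le.2 ⟨?_, ?_⟩))
    · have h2 := (h x).2
      have e1 : (#{q ∈ range m | A x (sample b u r q)} : ℝ) +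
          #{q ∈ range m | ¬ A x (sample b u r q)} = m := by
        exact_mod_cast (card_filter_add_card_filter_not (s := range m)
          (fun q => A x (sample b u r q))).trans (card_range m)
      have e2 : (Nat.count (A x) u : ℝ) + Nat.count (fun y => ¬ A x y) u = u := by
        rw [Nat.count_eq_card_filter_range, Nat.count_eq_card_filter_range]
        exact_mod_cast (card_filter_add_card_filter_not (s := range u) (A x)).trans (card_range u)
      have e3 : (Nat.count (fun y => ¬ A x y) u : ℝ) / u = 1 - (Nat.count (A x) u : ℝ) / u := by
        rw [eq_sub_iff_add_eq, ← add_div, add_comm, e2, div_self hu'.ne']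
      rw [e3] at h2
      linarith
    · linarith [(h x).1]
  have hupc : ∀ x, (#(up x) : ℝ) ≤ η * 2 ^ (m * b + c) := fun x =>
    card_sample_large_le hu (A x) hε hε1 hb
  have hloc : ∀ x, (#(lo x) : ℝ) ≤ η * 2 ^ (m * b + c) := fun x =>
    card_sample_large_le hu (fun y => ¬ A x y) hε hε1 hb
  have h1 : ((2 : ℝ) ^ (m * b + c)) ≤ #good + ∑ x : X, ((#(up x) : ℝ) + #(lo x)) := by
    have h2 : 2 ^ (m * b + c) ≤ #good + ∑ x : X, (#(up x) + #(lo x)) := by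
      calc 2 ^ (m * b + c) = #(univ : Finset (Fin (m * b + c) → Bool)) := by simp
        _ ≤ _ := (card_le_card hcover).trans ((card_union_le _ _).trans
          (Nat.add_le_add_left (card_biUnion_le.trans
            (sum_le_sum fun x _ => card_union_le _ _)) _))
    exact_mod_cast h2
  have h3 : ∑ x : X, ((#(up x) : ℝ) + #(lo x)) ≤
      ∑ _x : X, (η * 2 ^ (m * b + c) + η * 2 ^ (m * b + c)) :=
    sum_le_sum fun x _ => add_le_add (hupc x) (hloc x)
  rw [sum_const, card_univ, nsmul_eq_mul] at h3
  linarith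

open Finset in
theorem sum_card_blocks (P : ℕ → Prop) [DecidablePred P] (l s : ℕ) :
    ∑ j ∈ range l, #{p ∈ range s | P (j * s + p)} = #{q ∈ range (l * s) | P q} := by
  simp only [← Nat.count_eq_card_filter_range]
  induction l with
  | zero => simp
  | succ l ih => rw [sum_range_succ, ih, Nat.succ_mul, Nat.count_add]

/-! ### Representative samples of a set system and the gap -/

namespace SetSystem

variable (I : SetSystem)

/-- Whether the set with index `b` contains the element with index `y`; the indices that are out of
range stand for the empty set. -/
def mem (b y : ℕ) : Bool :=
  if h : b < I.sets.length ∧ y < I.u then decide (⟨y, h.2⟩ ∈ I.sets.get ⟨b, h.1⟩) else false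

theorem mem_iff {b y : ℕ} : I.mem b y = true ↔
    ∃ (h : b < I.sets.length) (h' : y < I.u), ⟨y, h'⟩ ∈ I.sets.get ⟨b, h⟩ := by
  rw [mem]
  split_ifs with h
  · simp [h]
  · simp only [false_iff, not_exists]
    exact fun h1 h2 => absurd ⟨h1, h2⟩ h

theorem cover_eq_count {k : ℕ} (i : Fin k → Fin I.sets.length) :
    I.cover i = Nat.count (fun y => ∃ j, I.mem (i j) y = true) I.u := by
  rw [cover, Nat.count_eq_card_filter_range]
  refine Finset.card_bij (fun y _ => (y : ℕ)) (fun y hy => ?_) (fun y _ y' _ h => Fin.ext h)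
    fun y hy => ?_
  · simp only [Finset.mem_biUnion, Finset.mem_univ, true_and] at hy
    obtain ⟨j, hj⟩ := hy
    exact Finset.mem_filter.2 ⟨Finset.mem_range.2 y.2, j, I.mem_iff.2 ⟨(i j).2, y.2, hj⟩⟩
  · obtain ⟨hy, j, hj⟩ := Finset.mem_filter.1 hy
    obtain ⟨_, h', hm⟩ := I.mem_iff.1 hj
    refine ⟨⟨y, h'⟩, ?_, rfl⟩
    simp only [Finset.mem_biUnion, Finset.mem_univ, true_and]
    exact ⟨j, hm⟩

/-- Indices out of range stand for the empty set. Replacing them by 0 can only enlarge the union,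
and if there are no sets at all, the union is empty. -/
theorem CoversAtMost.count_le {I : SetSystem} {k : ℕ} {c : ℝ} (h : I.CoversAtMost k c)
    (hc : 0 ≤ c) (x : Fin k → ℕ) :
    (Nat.count (fun y => ∃ j, I.mem (x j) y = true) I.u : ℝ) ≤ c * I.u := by
  by_cases h0 : 0 < I.sets.length
  · have := h fun j => if hj : x j < I.sets.length then ⟨x j, hj⟩ else ⟨0, h0⟩
    rw [cover_eq_count] at this
    refine le_trans (Nat.cast_le.2 (Nat.count_mono_left fun y _ hy => ?_)) this
    obtain ⟨j, hj⟩ := hy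
    have hlt := (I.mem_iff.1 hj).1
    exact ⟨j, by simpa [hlt] using hj⟩
  · have : Nat.count (fun y => ∃ j, I.mem (x j) y = true) I.u = 0 := by
      rw [Nat.count_iff_forall_not]
      rintro y - ⟨j, hj⟩
      have := (I.mem_iff.1 hj).1
      omega
    rw [this, Nat.cast_zero]
    exact mul_nonneg hc (Nat.cast_nonneg _)

end SetSystem

/-- The number of blocks of the sample. -/
def numBlocks (E k : ℕ) : ℕ := 4 * E ^ 2 * (k + 1) ^ 2

/-- The number of elements in each block of the sample. -/
def blockSize (k : ℕ) (I : SetSystem) : ℕ := Nat.log (k + 2) (I.size + 6) + 1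

/-- The number of random bits that are spent for each element of the sample. -/
def bitsPerSample (E : ℕ) (I : SetSystem) : ℕ := Nat.log 2 (I.u * E) + 1

/-- The sketch of a set system that is based on the random bits `r`, with precision `1 / E` and
target density `t / E`. -/
def sketch (E t k : ℕ) (I : SetSystem) {R : ℕ} (r : Fin R → Bool) : Sketch where
  l := numBlocks E k
  k := k
  s := blockSize k I
  D := k * E
  θ := k * numBlocks E k * t
  -- The extra index, an empty set, keeps the alphabet nonempty for an empty family.
  M := I.sets.length + 1
  -- The minimum bounds the base by a polynomial in the size alone; the bound k + 1 controls its
  -- powers.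
  B := min k (I.sets.length + 1) + 1
  hit := fun b q => I.mem b (sample (bitsPerSample E I) I.u r q)

open Finset in
/-- The sample has approximately the right density in every union of `k` sets. -/
def Representative (E k : ℕ) (I : SetSystem) {R : ℕ} (r : Fin R → Bool) : Prop :=
  ∀ x : Fin k → Fin (I.sets.length + 1),
    |(#{q ∈ range (numBlocks E k * blockSize k I) |
        ∃ j, I.mem (x j) (sample (bitsPerSample E I) I.u r q) = true} : ℝ) -
      (Nat.count (fun y => ∃ j, I.mem (x j) y = true) I.u : ℝ) / I.u *
        (numBlocks E k * blockSize k I : ℕ)| ≤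
      2 * (1 / (E : ℝ)) * (numBlocks E k * blockSize k I : ℕ)

/-- A fixed choice of k sets fails with probability at most 2 (N + 6)^-(k+1), and there are at most
(N + 6)^k choices. The 6 makes the error at most 1/3 for every N, as the Turing reduction needs. -/
theorem coinProb_representative {E k R : ℕ} {I : SetSystem} (hE : 0 < E) (hu : 0 < I.u)
    (hR : numBlocks E k * blockSize k I * bitsPerSample E I ≤ R) :
    1 - 2 / ((I.size : ℝ) + 6) ≤
      coinProb R {r : Fin R → Bool | Representative E k I r} := by
  have hE' : (0 : ℝ) < E := by exact_mod_cast hE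
  have hb : (I.u : ℝ) ≤ 1 / (E : ℝ) * 2 ^ bitsPerSample E I := by
    rw [div_mul_eq_mul_div, one_mul, le_div_iff₀ hE']
    exact_mod_cast (Nat.lt_pow_succ_log_self one_lt_two (I.u * E)).le
  refine le_trans ?_ (coinProb_sample hu (X := Fin k → Fin (I.sets.length + 1))
    (fun x y => ∃ j, I.mem (x j) y = true) (ε := 1 / (E : ℝ)) (by positivity)
    (by rw [div_le_one hE']; exact_mod_cast hE) hb hR)
  have hN : (0 : ℝ) < (I.size : ℝ) + 6 := by positivity
  -- This uses log (k + 2) ≤ k + 1 and spends one of the two factors k + 1 in `numBlocks`; the other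
  -- one pays for the union bound.
  have hlog : Real.log ((I.size : ℝ) + 6) ≤ (k + 1) * blockSize k I := by
    have h1 : ((I.size : ℝ) + 6) ≤ ((k : ℝ) + 2) ^ blockSize k I := by
      exact_mod_cast (Nat.lt_pow_succ_log_self (b := k + 2) (by omega) (I.size + 6)).le
    have h2 := Real.log_le_log hN h1
    rw [Real.log_pow] at h2
    have h3 := Real.log_le_sub_one_of_pos (x := (k : ℝ) + 2) (by positivity)
    calc _ ≤ _ := h2
      _ ≤ (blockSize k I : ℝ) * ((k : ℝ) + 2 - 1) := by gcongr
      _ = _ := by ring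
  have hm : ((1 / (E : ℝ)) ^ 2 * (numBlocks E k * blockSize k I : ℕ) / 4) =
      (k + 1) * ((k + 1) * blockSize k I) := by
    rw [numBlocks]
    push_cast
    field_simp
  have hexp : Real.exp (-((1 / (E : ℝ)) ^ 2 * (numBlocks E k * blockSize k I : ℕ) / 4)) ≤
      (((I.size : ℝ) + 6) ^ (k + 1))⁻¹ := by
    rw [hm, Real.exp_neg]
    gcongr
    rw [← Real.log_le_iff_le_exp (by positivity), Real.log_pow]
    push_cast
    gcongr
  have hM : ((I.sets.length : ℝ) + 1) ≤ (I.size : ℝ) + 6 := by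
    have : I.sets.length + 1 ≤ I.size + 6 := by rw [SetSystem.size]; omega
    exact_mod_cast this
  have hcard : (Fintype.card (Fin k → Fin (I.sets.length + 1)) : ℝ) =
      ((I.sets.length : ℝ) + 1) ^ k := by simp
  rw [hcard]
  have : 2 * ((I.sets.length : ℝ) + 1) ^ k *
      Real.exp (-((1 / (E : ℝ)) ^ 2 * (numBlocks E k * blockSize k I : ℕ) / 4)) ≤
      2 / ((I.size : ℝ) + 6) := by
    calc _ ≤ 2 * ((I.size : ℝ) + 6) ^ k * (((I.size : ℝ) + 6) ^ (k + 1))⁻¹ := by gcongr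
      _ = _ := by
        rw [pow_succ]
        field_simp
  linarith

section Reduction

variable {E t k R : ℕ} {I : SetSystem} {r : Fin R → Bool} {τ δ : ℝ}

theorem numBlocks_pos (hE : 0 < E) (k : ℕ) : 0 < numBlocks E k := by
  rw [numBlocks]; positivity

/-- The number of 2-CSP instances that are built. -/
def numGuesses (E k : ℕ) : ℕ := k * (k * E + 1) ^ (k * numBlocks E k)

/-- The leading factor k of `numGuesses` makes the list empty for k = 0, where an instance would
have no edges and hence no positive total weight. -/
theorem pos_of_lt_numGuesses {G : ℕ} (h : G < numGuesses E k) : 0 < k := by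
  rcases Nat.eq_zero_or_pos k with rfl | h'
  · simp [numGuesses] at h
  · exact h'

/-- The 2-CSP instances that are built from a set system with the random bits `r`. -/
def instances (hE : 0 < E) (t k : ℕ) (I : SetSystem) {R : ℕ} (r : Fin R → Bool) : List CSP :=
  List.ofFn fun G : Fin (numGuesses E k) => (sketch E t k I r).csp (numBlocks_pos hE k)
    (pos_of_lt_numGuesses G.2) (Nat.succ_pos _) (Nat.succ_pos _) G

/-- Each sampled element is labelled by the first chosen set that contains it. A nonzero label
occurs with density at least τ - 2/E, which is at least t/E. -/
theorem exists_instance_satisfiable (hE : 0 < E) (hu : 0 < I.u) (hr : Representative E k I r)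
    (hτ : 0 < τ) (ht : (t : ℝ) ≤ E * τ - 2) (h : I.CoversAtLeast k τ) :
    ∃ P ∈ instances hE t k I r, P.Satisfiable := by
  have hE' : (0 : ℝ) < E := by exact_mod_cast hE
  have hu' : (0 : ℝ) < I.u := by exact_mod_cast hu
  obtain ⟨i, hi⟩ := h
  have hk : 0 < k := by
    rcases Nat.eq_zero_or_pos k with rfl | h'
    · have : I.cover i = 0 := by simp [SetSystem.cover]
      rw [this, Nat.cast_zero] at hi
      exact absurd hi (not_le.2 (mul_pos hτ hu'))
    · exact h'
  set X := sketch E t k I r with hX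
  -- If k > M, choosing every set once covers at least as much, so that labels beyond `min k X.M`
  -- are never needed.
  obtain ⟨x, hxM, hxi⟩ : ∃ x : ℕ → ℕ, (∀ j, x j < X.M) ∧
      ∀ y j, I.mem (i j) y = true → ∃ j' < min k X.M, I.mem (x j') y = true := by
    by_cases hkM : k ≤ X.M
    · refine ⟨fun j => if hj : j < k then i ⟨j, hj⟩ else 0, fun j => ?_, fun y j hj => ?_⟩
      · beta_reduce
        split_ifs
        · exact (i _).2.trans (Nat.lt_succ_self _)
        · exact Nat.succ_pos _
      · exact ⟨j, by rw [min_eq_left hkM]; exact j.2, by simpa using hj⟩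
    · refine ⟨fun j => if j < X.M then j else 0, fun j => ?_, fun y j hj => ?_⟩
      · beta_reduce
        split_ifs with hj
        · exact hj
        · exact Nat.succ_pos _
      · have hlt : (i j : ℕ) < X.M := (i j).2.trans (Nat.lt_succ_self _)
        exact ⟨i j, by rw [min_eq_right (by omega)]; exact hlt, by simpa [hlt] using hj⟩
  classical
  set lab : ℕ → ℕ := fun q => if h : ∃ j' < min k X.M, X.hit (x j') q = true
    then Nat.find h + 1 else 0 with hlab
  have hlabB : ∀ q, lab q < X.B := fun q => by
    simp only [hlab]
    split_ifs with h
    · exact Nat.succ_lt_succ (Nat.find_spec h).1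
    · exact Nat.succ_pos _
  have hlabhit : ∀ q j, lab q = j + 1 → j < X.k ∧ X.hit (x j) q = true := fun q j hq => by
    simp only [hlab] at hq
    split_ifs at hq with h
    obtain rfl := Nat.succ_injective hq
    exact ⟨(Nat.find_spec h).1.trans_le (min_le_left _ _), (Nat.find_spec h).2⟩
  have hcard : Finset.card {q ∈ Finset.range (X.l * X.s) | ∃ j, X.hit (i j) q = true} ≤
      Finset.card {q ∈ Finset.range (X.l * X.s) | lab q ≠ 0} := by
    refine Finset.card_le_card fun q hq => ?_
    rw [Finset.mem_filter] at hq ⊢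
    obtain ⟨hq, j, hj⟩ := hq
    have hex : ∃ j' < min k X.M, X.hit (x j') q = true := hxi _ j hj
    exact ⟨hq, by simp only [hlab, hex, dite_true]; omega⟩
  have hrep := (abs_le.1 (hr fun j => (i j).castSucc)).1
  simp only [Fin.val_castSucc] at hrep
  rw [← I.cover_eq_count] at hrep
  have hdens : τ ≤ (I.cover i : ℝ) / I.u := by rwa [le_div_iff₀ hu']
  have hcount : (t : ℝ) * (X.l * X.s : ℕ) ≤
      E * (Finset.card {q ∈ Finset.range (X.l * X.s) | lab q ≠ 0} : ℝ) := by
    have h1 : (τ - 2 * (1 / (E : ℝ))) * (X.l * X.s : ℕ) ≤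
        (Finset.card {q ∈ Finset.range (X.l * X.s) | ∃ j, X.hit (i j) q = true} : ℝ) := by
      have := mul_le_mul_of_nonneg_right hdens (Nat.cast_nonneg (α := ℝ) (X.l * X.s))
      change -(2 * (1 / (E : ℝ)) * (X.l * X.s : ℕ)) ≤ (Finset.card {q ∈ Finset.range (X.l * X.s) |
        ∃ j, X.hit (i j) q = true} : ℝ) - (I.cover i : ℝ) / I.u * (X.l * X.s : ℕ) at hrep
      linarith
    calc (t : ℝ) * (X.l * X.s : ℕ) ≤ (E * τ - 2) * (X.l * X.s : ℕ) := by gcongr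
      _ = E * ((τ - 2 * (1 / (E : ℝ))) * (X.l * X.s : ℕ)) := by field_simp
      _ ≤ E * (Finset.card {q ∈ Finset.range (X.l * X.s) | lab q ≠ 0} : ℝ) := by
        gcongr
        exact h1.trans (by exact_mod_cast hcard)
  have hcount' : t * (X.l * X.s) ≤
      E * Finset.card {q ∈ Finset.range (X.l * X.s) | lab q ≠ 0} := by exact_mod_cast hcount
  obtain ⟨G, hG, hsat⟩ := X.exists_satisfiable (numBlocks_pos hE k) hk (Nat.succ_pos _)
    (Nat.succ_pos _) (Nat.succ_pos _) x (fun j _ => hxM j) lab hlabB hlabhit (by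
      rw [sum_card_blocks (fun q => lab q ≠ 0)]
      calc X.θ * X.s = k * (t * (X.l * X.s)) := by
            change k * numBlocks E k * t * X.s = k * (t * (numBlocks E k * X.s))
            ring
        _ ≤ k * (E * Finset.card {q ∈ Finset.range (X.l * X.s) | lab q ≠ 0}) := by gcongr
        _ = _ := by rw [← mul_assoc]; rfl)
  have hG' : G < numGuesses E k := hG.trans_le (Nat.le_mul_of_pos_left _ hk)
  exact ⟨_, List.mem_ofFn.2 ⟨⟨G, hG'⟩, rfl⟩, hsat⟩

/-- In units of k l s, the satisfied weight is at most E(1-δ)τ + 3, where 2 is due to the sampling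
error 2/E and 1 to the added ones; the total weight is at least t. -/
theorem instances_valueAtMost (hE : 0 < E) (hu : 0 < I.u) (hr : Representative E k I r)
    (hτ : 0 < τ) (hδ : 0 < δ) (hδ' : δ ≤ 1 / 2) (hEδ : 10 ≤ E * δ * τ)
    (ht : (E : ℝ) * τ - 5 ≤ t) (h : I.CoversAtMost k ((1 - δ) * τ)) :
    ∀ P ∈ instances hE t k I r, P.ValueAtMost (1 - δ ^ 2 / 4) := by
  have hE' : (0 : ℝ) < E := by exact_mod_cast hE
  have hu' : (0 : ℝ) < I.u := by exact_mod_cast hu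
  intro P hP
  obtain ⟨G, rfl⟩ := List.mem_ofFn.1 hP
  refine Sketch.valueAtMost _ _ _ _ _ (Nat.succ_pos _) (by nlinarith) (fun x hx => ?_) _
  have hcov := h.count_le (mul_nonneg (by linarith) hτ.le) fun j : Fin k => x j
  have hrep := (abs_le.1 (hr fun j => ⟨x j, hx j j.2⟩)).2
  set X := sketch E t k I r with hX
  -- As δ² ≤ δ/2, the loss δ²Eτ/4 is at most Eδτ/8. It remains that 7/8 · Eδτ ≥ 8, which follows
  -- from Eδτ ≥ 10.
  have hσ : E * ((1 - δ) * τ) + 3 ≤ (1 - δ ^ 2 / 4) * t := by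
    have h1 : (1 - δ ^ 2 / 4) * (E * τ - 5) ≤ (1 - δ ^ 2 / 4) * t := by
      gcongr
      nlinarith
    have h2 : E * τ * δ ^ 2 ≤ E * τ * (δ * (1 / 2)) := by
      rw [pow_two]
      gcongr
    nlinarith [sq_nonneg δ]
  rw [sum_card_blocks (fun q => ∃ i < X.k, X.hit (x i) q = true)]
  have hset : Finset.card {q ∈ Finset.range (X.l * X.s) | ∃ i < X.k, X.hit (x i) q = true} =
      Finset.card {q ∈ Finset.range (X.l * X.s) | ∃ j : Fin k, X.hit (x j) q = true} := by
    congr 1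
    refine Finset.filter_congr fun q _ => ?_
    exact ⟨fun ⟨i, hi, h⟩ => ⟨⟨i, hi⟩, h⟩, fun ⟨j, h⟩ => ⟨j, j.2, h⟩⟩
  rw [hset]
  have hcard : (Finset.card {q ∈ Finset.range (X.l * X.s) | ∃ j : Fin k, X.hit (x j) q = true} : ℝ) ≤
      ((1 - δ) * τ + 2 * (1 / (E : ℝ))) * (X.l * X.s : ℕ) := by
    change (Finset.card {q ∈ Finset.range (X.l * X.s) | ∃ j : Fin k, X.hit (x j) q = true} : ℝ) -
      (Nat.count (fun y => ∃ j : Fin k, I.mem (x j) y = true) I.u : ℝ) / I.u * (X.l * X.s : ℕ) ≤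
      2 * (1 / (E : ℝ)) * (X.l * X.s : ℕ) at hrep
    have h1 : (Nat.count (fun y => ∃ j : Fin k, I.mem (x j) y = true) I.u : ℝ) / I.u ≤
        (1 - δ) * τ := by rwa [div_le_iff₀ hu']
    have := mul_le_mul_of_nonneg_right h1 (Nat.cast_nonneg (α := ℝ) (X.l * X.s))
    linarith
  have hD : (X.D : ℝ) = k * E := Nat.cast_mul _ _
  have hθ : (X.θ : ℝ) = k * X.l * t := by
    change ((k * numBlocks E k * t : ℕ) : ℝ) = k * (numBlocks E k : ℕ) * t
    push_cast
    ring
  rw [hD, hθ]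
  calc _ ≤ (k : ℝ) * E * (((1 - δ) * τ + 2 * (1 / (E : ℝ))) * (X.l * X.s : ℕ)) +
        k * X.l * X.s := by gcongr; rfl
    _ = k * X.l * X.s * (E * ((1 - δ) * τ) + 3) := by
        push_cast
        field_simp
        ring
    _ ≤ k * X.l * X.s * ((1 - δ ^ 2 / 4) * t) := by gcongr
    _ = _ := by ring

/-- The number of variables of the 2-CSP instances that are built. -/
def numVars (E k : ℕ) : ℕ := numBlocks E k + k

/-- A bound on the sizes of the alphabets. -/
theorem alphabet_le (k : ℕ) (I : SetSystem) :
    (min k (I.sets.length + 1) + 1) ^ blockSize k I ≤ (I.size + 2) * (I.size + 6) := by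
  rw [blockSize, pow_succ, mul_comm]
  refine Nat.mul_le_mul ?_ ?_
  · have : I.sets.length ≤ I.size := Nat.le_add_left _ _
    omega
  -- The base is at most k + 2, the base of the logarithm in `blockSize`.
  · exact (Nat.pow_le_pow_left (by omega) _).trans (Nat.pow_log_le_self _ (by omega))

theorem instances_size (hE : 0 < E) : ∀ P ∈ instances hE t k I r,
    P.n = numVars E k ∧ ∀ v, P.alph v ≤ (I.size + 2) * (I.size + 6) := by
  intro P hP
  obtain ⟨G, rfl⟩ := List.mem_ofFn.1 hP
  refine ⟨rfl, fun v => ?_⟩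
  simp only [Sketch.csp]
  split_ifs
  · exact alphabet_le k I
  · change I.sets.length + 1 ≤ _
    have : I.sets.length ≤ I.size := Nat.le_add_left _ _
    nlinarith

end Reduction

/-! ### Evaluation of the instances in FPT time -/

theorem Computable.natAdd {α : Type*} [Primcodable α] {f g : α → ℕ} (hf : Computable f)
    (hg : Computable g) : Computable fun a => f a + g a :=
  Primrec.nat_add.to_comp.comp hf hg

theorem Computable.natMul {α : Type*} [Primcodable α] {f g : α → ℕ} (hf : Computable f)
    (hg : Computable g) : Computable fun a => f a * g a :=
  Primrec.nat_mul.to_comp.comp hf hg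

theorem Computable.natPow {α : Type*} [Primcodable α] {f g : α → ℕ} (hf : Computable f)
    (hg : Computable g) : Computable fun a => f a ^ g a := by
  refine (Computable.nat_rec (h := fun a (y : ℕ × ℕ) => y.2 * f a) hg (Computable.const 1)
    (Computable.natMul (Computable.snd.comp .snd) (hf.comp .fst))).of_eq fun a => ?_
  induction g a with
  | zero => rfl
  | succ n ih =>
    rw [pow_succ, ← ih]

namespace Ctx

variable {ι κ : Type} {Γ : Ctx ι}

/-- Some program computes the number `f i` in FPT time, and this number is bounded. -/
structure IsNat (Γ : Ctx ι) (f : ι → ℕ) : Prop where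
  eval : Γ.EvalNat f
  bdd : Γ.Bounded f

namespace IsNat

theorem of_eq {f g : ι → ℕ} (hf : Γ.IsNat f) (h : ∀ i, f i = g i) : Γ.IsNat g := by
  rwa [← funext h]

theorem const (n : ℕ) : Γ.IsNat (fun _ => n) := ⟨.const n, .const n⟩

theorem succ {f : ι → ℕ} (hf : Γ.IsNat f) : Γ.IsNat (fun i => f i + 1) :=
  ⟨hf.1.succ, hf.2.add (.const 1)⟩

theorem add {f g : ι → ℕ} (hf : Γ.IsNat f) (hg : Γ.IsNat g) : Γ.IsNat (fun i => f i + g i) :=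
  ⟨hf.1.add hg.1 hg.2, hf.2.add hg.2⟩

theorem mul {f g : ι → ℕ} (hf : Γ.IsNat f) (hg : Γ.IsNat g) : Γ.IsNat (fun i => f i * g i) :=
  ⟨hf.1.mul hf.2 hg.1 hg.2, hf.2.mul hg.2⟩

theorem sub {f g : ι → ℕ} (hf : Γ.IsNat f) (hg : Γ.IsNat g) : Γ.IsNat (fun i => f i - g i) :=
  ⟨hf.1.sub hg.1 hg.2, hf.2.mono fun _ => Nat.sub_le _ _⟩

theorem min {f g : ι → ℕ} (hf : Γ.IsNat f) (hg : Γ.IsNat g) :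
    Γ.IsNat (fun i => min (f i) (g i)) :=
  ⟨hf.1.min hg.1 hg.2, hf.2.mono fun _ => min_le_left _ _⟩

theorem div {f g : ι → ℕ} (hf : Γ.IsNat f) (hg : Γ.IsNat g) (h : ∀ i, 0 < g i) :
    Γ.IsNat (fun i => f i / g i) :=
  ⟨hf.1.div hf.2 hg.1 hg.2 h, hf.2.mono fun _ => Nat.div_le_self _ _⟩

theorem mod {f g : ι → ℕ} (hf : Γ.IsNat f) (hg : Γ.IsNat g) (h : ∀ i, 0 < g i) :
    Γ.IsNat (fun i => f i % g i) :=
  ⟨hf.1.mod hf.2 hg.1 hg.2 h, hf.2.mono fun _ => Nat.mod_le _ _⟩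

theorem pow {f g : ι → ℕ} (hf : Γ.IsNat f) (hg : Γ.IsNat g) (h : ∀ i, 0 < f i)
    (hb : Γ.Bounded (fun i => f i ^ g i)) : Γ.IsNat (fun i => f i ^ g i) :=
  ⟨hf.1.pow hf.2 hg.1 hg.2 h hb, hb⟩

theorem log {f g : ι → ℕ} (hf : Γ.IsNat f) (hg : Γ.IsNat g) (h : ∀ i, 1 < f i) :
    Γ.IsNat (fun i => Nat.log (f i) (g i)) :=
  ⟨hf.1.log hf.2 hg.1 hg.2 h, hg.2.mono fun _ => Nat.log_le_self _ _⟩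

theorem digit {B a p : ι → ℕ} (hB : Γ.IsNat B) (ha : Γ.IsNat a) (hp : Γ.IsNat p)
    (h : ∀ i, 0 < B i) (hb : Γ.Bounded (fun i => B i ^ p i)) :
    Γ.IsNat (fun i => digit (B i) (a i) (p i)) :=
  (ha.div (hB.pow hp h hb) fun i => Nat.pow_pos (h i)).mod hB h

theorem ite {c : ι → Bool} {f g : ι → ℕ} (hc : Γ.EvalBool c) (hf : Γ.IsNat f) (hg : Γ.IsNat g) :
    Γ.IsNat (fun i => if c i = true then f i else g i) :=
  ⟨.ite hc hf.1 hg.1, (hf.2.add hg.2).mono fun i => by split_ifs <;> omega⟩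

theorem lift {f n : ι → ℕ} (hf : Γ.IsNat f) : (Γ.below n).IsNat (fun x => f x.1) :=
  ⟨hf.1.lift_below, hf.2.lift_below⟩

theorem idx {n : ι → ℕ} (hn : Γ.IsNat n) : (Γ.below n).IsNat (fun x => x.2) :=
  ⟨Evaluates.idx, hn.2.idx_below⟩

theorem count {n : ι → ℕ} (P : ι → ℕ → Bool) (hn : Γ.IsNat n)
    (hP : (Γ.below n).EvalBool (fun x => P x.1 x.2)) :
    Γ.IsNat (fun i => Nat.count (fun j => P i j = true) (n i)) :=
  ⟨.count P hn.1 hn.2 hP, hn.2.mono fun _ => Nat.count_le _⟩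

theorem sum {n : ι → ℕ} (f : ι → ℕ → ℕ) (hn : Γ.IsNat n)
    (hf : (Γ.below n).IsNat (fun x => f x.1 x.2)) :
    Γ.IsNat (fun i => ∑ j ∈ Finset.range (n i), f i j) := by
  refine ⟨.sum f hn.1 hn.2 hf.1 hf.2, ?_⟩
  obtain ⟨T, q, hT, hq⟩ := hf.2
  have hB : Γ.Bounded (fun i => T (Γ.par i) * q.eval (Γ.len i)) := ⟨T, q, hT, fun _ => le_rfl⟩
  refine (hn.2.mul hB).mono fun i => ?_
  refine (Finset.sum_le_card_nsmul _ _ (T (Γ.par i) * q.eval (Γ.len i)) fun j hj => ?_).trans ?_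
  · exact hq ⟨i, j, Finset.mem_range.1 hj⟩
  · simp

theorem decide_le {f g : ι → ℕ} (hf : Γ.IsNat f) (hg : Γ.IsNat g) :
    Γ.EvalBool (fun i => decide (f i ≤ g i)) :=
  .le hf.1 hg.1 hg.2

theorem decide_lt {f g : ι → ℕ} (hf : Γ.IsNat f) (hg : Γ.IsNat g) :
    Γ.EvalBool (fun i => decide (f i < g i)) :=
  .lt hf.1 hg.1 hg.2

theorem decide_eq {f g : ι → ℕ} (hf : Γ.IsNat f) (hg : Γ.IsNat g) :
    Γ.EvalBool (fun i => decide (f i = g i)) :=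
  .eq hf.1 hf.2 hg.1 hg.2

theorem sum_sum {n m : ι → ℕ} (f : ι → ℕ → ℕ → ℕ) (hn : Γ.IsNat n) (hm : Γ.IsNat m)
    (hf : ((Γ.below n).below fun x => m x.1).IsNat (fun x => f x.1.1 x.1.2 x.2)) :
    Γ.IsNat (fun i => ∑ j ∈ Finset.range (n i), ∑ l ∈ Finset.range (m i), f i j l) :=
  sum (fun i j => ∑ l ∈ Finset.range (m i), f i j l) hn
    (sum (n := fun x => m x.1) (fun (x : Σ i, Fin (n i)) l => f x.1 x.2 l) hm.lift hf)

end IsNat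

theorem Evaluates.ofFn' {n : ι → ℕ} {f : (Σ i, Fin (n i)) → Data} (hn : Γ.IsNat n)
    (hf : (Γ.below n).Evaluates f) :
    Γ.Evaluates (fun i => Data.list (List.ofFn fun j : Fin (n i) => f ⟨i, j⟩)) :=
  .ofFn hn.1 hn.2 hf

end Ctx

/-- An input of the reduction: a parameter, a set system and random bits; and an oracle. -/
structure Input where
  oracle : Set Data
  k : ℕ
  I : SetSystem
  R : ℕ
  r : Fin R → Bool
  u_pos : 0 < I.u

/-- The inputs of the reduction as a context. -/
def inputCtx : Ctx Input where
  par := fun x => x.k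
  len := fun x => x.I.size
  oracle := fun x => x.oracle
  env := fun x => withCoins (Data.cons (Data.num x.k) x.I.encode) x.r

/-- The input `φ x` of the reduction is part of the environment `Δ.env x`. -/
structure Extends {κ : Type} (Δ : Ctx κ) (φ : κ → Input) : Prop where
  par_eq : ∀ x, Δ.par x = (φ x).k
  len_eq : ∀ x, Δ.len x = (φ x).I.size
  oracle_eq : ∀ x, Δ.oracle x = (φ x).oracle
  env : Δ.Evaluates (fun x => inputCtx.env (φ x))

theorem extends_inputCtx : Extends inputCtx (fun x => x) :=
  ⟨fun _ => rfl, fun _ => rfl, fun _ => rfl, .env⟩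

namespace Extends

variable {κ : Type} {Δ : Ctx κ} {φ : κ → Input}

theorem below (h : Extends Δ φ) (n : κ → ℕ) : Extends (Δ.below n) (fun x => φ x.1) :=
  ⟨fun x => h.par_eq x.1, fun x => h.len_eq x.1, fun x => h.oracle_eq x.1, h.env.lift_below⟩

theorem k (h : Extends Δ φ) : Δ.IsNat (fun x => (φ x).k) :=
  ⟨h.env.hd.hd, (Ctx.Bounded.par Computable.id).mono fun x => (h.par_eq x).ge⟩

theorem ofPar (h : Extends Δ φ) {f : ℕ → ℕ} (hf : Computable f) :
    Δ.IsNat (fun x => f (φ x).k) := by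
  have hk : Δ.EvalNat Δ.par := h.k.1.of_eq fun x => (h.par_eq x).symm
  refine Ctx.IsNat.of_eq (f := fun x => f (Δ.par x)) ⟨.computable hf hk, .par hf⟩ fun x => ?_
  rw [h.par_eq]

theorem boundedPar (h : Extends Δ φ) {f : ℕ → ℕ} (hf : Computable f) :
    Δ.Bounded (fun x => f (φ x).k) :=
  (h.ofPar hf).2

theorem bounded_size (h : Extends Δ φ) : Δ.Bounded (fun x => (φ x).I.size) :=
  Ctx.Bounded.len.mono fun x => (h.len_eq x).ge

theorem u (h : Extends Δ φ) : Δ.IsNat (fun x => (φ x).I.u) :=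
  ⟨h.env.hd.tl.hd, h.bounded_size.mono fun _ => Nat.le_add_right _ _⟩

theorem sets_length (h : Extends Δ φ) : Δ.IsNat (fun x => (φ x).I.sets.length) := by
  have hb : Δ.Bounded (fun x => (φ x).I.sets.length) :=
    h.bounded_size.mono fun _ => Nat.le_add_left _ _
  have hd := Ctx.Evaluates.length (Γ := Δ) (xs := fun x => (φ x).I.sets.map fun s =>
    Data.list (List.ofFn fun y : Fin (φ x).I.u => Data.bit (decide (y ∈ s)))) h.env.hd.tl.tl
    (by simpa using hb)
  exact ⟨by simpa using hd, hb⟩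

theorem size (h : Extends Δ φ) : Δ.IsNat (fun x => (φ x).I.size) :=
  h.u.add h.sets_length

/-- Reading beyond the end of a list gives `nil`, the code of `false`. This explains the default
value in `coin`, and likewise in `SetSystem.mem`. -/
theorem coin (h : Extends Δ φ) {q : κ → ℕ} (hq : Δ.IsNat q) :
    Δ.EvalBool (fun x => coin (φ x).r (q x)) := by
  refine (Ctx.Evaluates.nth h.env.tl hq.1 hq.2).of_eq fun x => ?_
  simp only [inputCtx, withCoins, Data.tl, Data.nth_list, MaxCovCSP.coin]
  split_ifs with hlt
  · simp [hlt]
  · simp [hlt, Data.bit]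

theorem mem (h : Extends Δ φ) {b y : κ → ℕ} (hb : Δ.IsNat b) (hy : Δ.IsNat y) :
    Δ.EvalBool (fun x => (φ x).I.mem (b x) (y x)) := by
  refine (Ctx.Evaluates.nth (Ctx.Evaluates.nth h.env.hd.tl.tl hb.1 hb.2) hy.1 hy.2).of_eq
    fun x => ?_
  simp only [inputCtx, withCoins, Data.hd, Data.tl, SetSystem.encode, Data.nth_list, SetSystem.mem]
  by_cases hlt : b x < (φ x).I.sets.length
  · by_cases hlt' : y x < (φ x).I.u
    · simp [hlt, hlt', Data.nth_list]
    · simp [hlt, hlt', Data.nth_list, Data.bit]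
  · have : ∀ n, Data.nil.nth n = Data.nil := fun n => Data.nth_list [] n
    simp [hlt, this, Data.bit]

variable {E t : ℕ → ℕ}

theorem numBlocks (h : Extends Δ φ) (hE : Computable E) :
    Δ.IsNat (fun x => numBlocks (E (φ x).k) (φ x).k) :=
  (((Ctx.IsNat.const 4).mul ((h.ofPar hE).mul (h.ofPar hE))).mul (h.k.succ.mul h.k.succ)).of_eq
    fun x => by rw [MaxCovCSP.numBlocks]; ring

theorem blockSize (h : Extends Δ φ) : Δ.IsNat (fun x => blockSize (φ x).k (φ x).I) :=
  ((h.k.add (.const 2)).log (h.size.add (.const 6)) fun _ => by omega).succ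

theorem bitsPerSample (h : Extends Δ φ) (hE : Computable E) :
    Δ.IsNat (fun x => bitsPerSample (E (φ x).k) (φ x).I) :=
  ((Ctx.IsNat.const 2).log (h.u.mul (h.ofPar hE)) fun _ => one_lt_two).succ

theorem sample (h : Extends Δ φ) (hE : Computable E) (hpos : ∀ k, 0 < E k) {q : κ → ℕ}
    (hq : Δ.IsNat q) :
    Δ.IsNat (fun x => sample (MaxCovCSP.bitsPerSample (E (φ x).k) (φ x).I) (φ x).I.u (φ x).r (q x)) := by
  have hb := h.bitsPerSample hE
  refine (Ctx.IsNat.sum (fun x j => if MaxCovCSP.coin (φ x).r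
    (q x * MaxCovCSP.bitsPerSample (E (φ x).k) (φ x).I + j) = true then 2 ^ j else 0) hb
    ?_).mod h.u fun x => (φ x).u_pos
  refine Ctx.IsNat.ite ((h.below _).coin ((hq.mul hb).lift.add hb.idx))
    ((Ctx.IsNat.const 2).pow hb.idx (fun _ => two_pos) ?_) (.const 0)
  -- The powers of 2 are written out in unary, so they must be bounded: 2^b ≤ 2 u E.
  refine (((Ctx.Bounded.const 2).mul (h.u.mul (h.ofPar hE)).2).lift_below).mono fun x => ?_
  have hne : (φ x.1).I.u * E (φ x.1).k ≠ 0 := (Nat.mul_pos (φ x.1).u_pos (hpos _)).ne'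
  calc 2 ^ (x.2 : ℕ) ≤ 2 ^ MaxCovCSP.bitsPerSample (E (φ x.1).k) (φ x.1).I :=
        Nat.pow_le_pow_right two_pos x.2.2.le
    _ = 2 * 2 ^ Nat.log 2 ((φ x.1).I.u * E (φ x.1).k) := by
        rw [MaxCovCSP.bitsPerSample, pow_succ, mul_comm]
    _ ≤ _ := Nat.mul_le_mul_left _ (Nat.pow_log_le_self _ hne)

end Extends

section Reduction

variable {κ : Type} {Δ : Ctx κ} {φ : κ → Input} {E t : ℕ → ℕ}

/-- The sketch for an input of the reduction. -/
def Input.sketch (E t : ℕ → ℕ) (x : Input) : Sketch :=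
  MaxCovCSP.sketch (E x.k) (t x.k) x.k x.I x.r

namespace Extends

theorem sketch_D (h : Extends Δ φ) (hE : Computable E) :
    Δ.IsNat (fun x => ((φ x).sketch E t).D) :=
  h.k.mul (h.ofPar hE)

theorem sketch_B (h : Extends Δ φ) : Δ.IsNat (fun x => ((φ x).sketch E t).B) :=
  (h.k.min h.sets_length.succ).succ

theorem hit (h : Extends Δ φ) (hE : Computable E) (hpos : ∀ k, 0 < E k) {b q : κ → ℕ}
    (hb : Δ.IsNat b) (hq : Δ.IsNat q) :
    Δ.EvalBool (fun x => ((φ x).sketch E t).hit (b x) (q x)) :=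
  h.mem hb (h.sample hE hpos hq)

theorem bounded_alphabet (h : Extends Δ φ) :
    Δ.Bounded (fun x => ((φ x).sketch E t).B ^ ((φ x).sketch E t).s) :=
  ((h.bounded_size.add (.const 2)).mul (h.bounded_size.add (.const 6))).mono
    fun _ => alphabet_le _ _

theorem blockCount (h : Extends Δ φ) (hE : Computable E) (hpos : ∀ k, 0 < E k) {a b j i : κ → ℕ}
    (ha : Δ.IsNat a) (hb : Δ.IsNat b) (hj : Δ.IsNat j) (hi : Δ.IsNat i) :
    Δ.IsNat (fun x => ((φ x).sketch E t).blockCount (a x) (b x) (j x) (i x)) := by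
  have hs : Δ.IsNat (fun x => ((φ x).sketch E t).s) := h.blockSize
  refine Ctx.IsNat.count (fun x p => decide (digit ((φ x).sketch E t).B (a x) p = i x + 1) &&
    ((φ x).sketch E t).hit (b x) (j x * ((φ x).sketch E t).s + p)) hs (Ctx.EvalBool.and ?_
    ((h.below _).hit hE hpos hb.lift ((hj.mul hs).lift.add hs.idx)))
  refine Ctx.IsNat.decide_eq (Ctx.IsNat.digit h.sketch_B.lift ha.lift hs.idx
    (fun _ => Nat.succ_pos _) ?_) hi.succ.lift
  exact (h.bounded_alphabet (E := E) (t := t)).lift_below.mono fun x =>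
    Nat.pow_le_pow_right (Nat.succ_pos _) x.2.2.le

/-- Extracting a digit computes the power (D + 1)^(j k + i). Bounding the position by f makes this
power bounded in terms of k alone. -/
theorem guess (h : Extends Δ φ) (hE : Computable E) {f : ℕ → ℕ} (hf : Computable f)
    {G j i : κ → ℕ} (hG : Δ.IsNat G) (hj : Δ.IsNat j) (hi : Δ.IsNat i)
    (hle : ∀ x, j x * (φ x).k + i x ≤ f (φ x).k) :
    Δ.IsNat (fun x => ((φ x).sketch E t).guess (G x) (j x) (i x)) := by
  refine Ctx.IsNat.digit (h.sketch_D hE).succ hG ((hj.mul h.k).add hi) (fun _ => Nat.succ_pos _) ?_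
  refine (h.boundedPar (f := fun k => (k * E k + 1) ^ f k) ?_).mono fun x =>
    Nat.pow_le_pow_right (Nat.succ_pos _) (hle x)
  exact Computable.natPow (Computable.natAdd (Computable.natMul .id hE) (.const 1)) hf

end Extends

theorem computable_numBlocks (hE : Computable E) : Computable fun k => numBlocks (E k) k := by
  have h1 := Computable.natAdd Computable.id (Computable.const 1)
  refine (Computable.natMul (Computable.natMul (Computable.const 4) (Computable.natMul hE hE))
    (Computable.natMul h1 h1)).of_eq fun k => ?_
  rw [numBlocks]
  simp only [id]
  ring

theorem computable_numVars (hE : Computable E) : Computable fun k => numVars (E k) k :=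
  Computable.natAdd (computable_numBlocks hE) .id

theorem computable_numGuesses (hE : Computable E) : Computable fun k => numGuesses (E k) k :=
  Computable.natMul .id (Computable.natPow (Computable.natAdd (Computable.natMul .id hE) (.const 1))
    (Computable.natMul .id (computable_numBlocks hE)))

theorem Extends.guessSum (h : Extends Δ φ) (hE : Computable E) {G : κ → ℕ} (hG : Δ.IsNat G) :
    Δ.IsNat (fun x => ((φ x).sketch E t).guessSum (G x)) := by
  have hl : Δ.IsNat (fun x => ((φ x).sketch E t).l) := h.numBlocks hE
  have hk : (Δ.below fun x => ((φ x).sketch E t).l).IsNat (fun x => ((φ x.1).sketch E t).k) :=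
    (h.below _).k
  have hf : Computable fun k => MaxCovCSP.numBlocks (E k) k * k + k :=
    Computable.natAdd (f := fun k => MaxCovCSP.numBlocks (E k) k * k) (g := fun k => k)
      (Computable.natMul (g := fun k => k) (computable_numBlocks hE) .id) .id
  have hle : ∀ x : Σ x : (Σ x, Fin ((φ x).sketch E t).l), Fin ((φ x.1).sketch E t).k,
      (x.1.2 : ℕ) * (φ x.1.1).k + x.2 ≤
        MaxCovCSP.numBlocks (E (φ x.1.1).k) (φ x.1.1).k * (φ x.1.1).k + (φ x.1.1).k := fun x =>
    Nat.add_le_add (Nat.mul_le_mul_right _ (Fin.is_le' (a := x.1.2))) (Fin.is_le' (a := x.2))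
  have hg : ((Δ.below fun x => ((φ x).sketch E t).l).below
      fun x => ((φ x.1).sketch E t).k).IsNat
      (fun x => ((φ x.1.1).sketch E t).guess (G x.1.1) x.1.2 x.2) :=
    ((h.below fun x => ((φ x).sketch E t).l).below fun x => ((φ x.1).sketch E t).k).guess
      (t := t) hE hf hG.lift.lift hl.idx.lift hk.idx hle
  exact Ctx.IsNat.sum_sum (m := fun x => ((φ x).sketch E t).k)
    (fun x j i => ((φ x).sketch E t).guess (G x) j i + 1) hl h.k hg.succ

theorem Extends.relVal (h : Extends Δ φ) (hE : Computable E) (ht : Computable t)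
    (hpos : ∀ k, 0 < E k) {f : ℕ → ℕ} (hf : Computable f) {G j i a b : κ → ℕ} (hG : Δ.IsNat G)
    (hj : Δ.IsNat j) (hi : Δ.IsNat i) (ha : Δ.IsNat a) (hb : Δ.IsNat b)
    (hle : ∀ x, j x * (φ x).k + i x ≤ f (φ x).k) :
    Δ.EvalBool (fun x => ((φ x).sketch E t).relVal (G x) (j x) (i x) (a x) (b x)) :=
  Ctx.EvalBool.and
    (((h.k.mul (h.numBlocks hE)).mul (h.ofPar ht)).decide_le (h.guessSum hE hG))
    (((h.guess hE hf hG hj hi hle).mul h.blockSize).decide_le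
      ((h.sketch_D (t := t) hE).mul (h.blockCount hE hpos ha hb hj hi)))

/-- The size of the alphabet of the variable `v`. -/
abbrev Sketch.alphSize (X : Sketch) (v : ℕ) : ℕ := if v < X.l then X.B ^ X.s else X.M

theorem Extends.alphSize (h : Extends Δ φ) (hE : Computable E) {v : κ → ℕ} (hv : Δ.IsNat v) :
    Δ.IsNat (fun x => ((φ x).sketch E t).alphSize (v x)) := by
  have hl : Δ.IsNat (fun x => ((φ x).sketch E t).l) := h.numBlocks hE
  have hA : Δ.IsNat (fun x => ((φ x).sketch E t).B ^ ((φ x).sketch E t).s) :=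
    Ctx.IsNat.pow h.sketch_B h.blockSize (fun _ => Nat.succ_pos _) h.bounded_alphabet
  have hM : Δ.IsNat (fun x => ((φ x).sketch E t).M) := h.sets_length.succ
  exact (Ctx.IsNat.ite (hv.decide_lt hl) hA hM).of_eq fun x => by
    simp only [decide_eq_true_iff]

/-- The data for the pair `(u, v)` of variables. -/
def Sketch.entry (X : Sketch) (G u v : ℕ) : Data :=
  if (decide (u < X.l) && decide (X.l ≤ v)) = true then
    Data.cons (Data.num (X.guess G u (v - X.l) + 1))
      (Data.list (List.ofFn fun a : Fin (X.alphSize u) => Data.list (List.ofFn fun b :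
        Fin (X.alphSize v) => Data.bit (X.relVal G u (v - X.l) a b))))
  else Data.nil

theorem Extends.entry (h : Extends Δ φ) (hE : Computable E) (ht : Computable t)
    (hpos : ∀ k, 0 < E k) {G u v : κ → ℕ} (hG : Δ.IsNat G) (hu : Δ.IsNat u) (hv : Δ.IsNat v)
    (hun : ∀ x, u x ≤ numVars (E (φ x).k) (φ x).k) (hvn : ∀ x, v x ≤ numVars (E (φ x).k) (φ x).k) :
    Δ.Evaluates (fun x => ((φ x).sketch E t).entry (G x) (u x) (v x)) := by
  have hl : Δ.IsNat (fun x => ((φ x).sketch E t).l) := h.numBlocks hE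
  have hf : Computable fun k => numVars (E k) k * k + numVars (E k) k :=
    Computable.natAdd (Computable.natMul (computable_numVars hE) .id) (computable_numVars hE)
  have hi := hv.sub hl
  have hle : ∀ x, u x * (φ x).k + (v x - ((φ x).sketch E t).l) ≤
      numVars (E (φ x).k) (φ x).k * (φ x).k + numVars (E (φ x).k) (φ x).k := fun x =>
    Nat.add_le_add (Nat.mul_le_mul_right _ (hun x)) ((Nat.sub_le _ _).trans (hvn x))
  have hwt := (h.guess (t := t) hE hf hG hu hi hle).succ
  have hau := h.alphSize (t := t) hE hu
  have hav := h.alphSize (t := t) hE hv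
  have hrel := ((h.below fun x => ((φ x).sketch E t).alphSize (u x)).below
    fun x => ((φ x.1).sketch E t).alphSize (v x.1)).relVal hE ht hpos hf hG.lift.lift hu.lift.lift
    hi.lift.lift hau.idx.lift hav.lift.idx fun x => hle x.1.1
  exact Ctx.Evaluates.ite (Ctx.EvalBool.and (hu.decide_lt hl) (hl.decide_le hv))
    (Ctx.Evaluates.cons hwt.1 (Ctx.Evaluates.ofFn' hau (Ctx.Evaluates.ofFn' hav.lift hrel))) .nil

theorem Sketch.encode_csp (X : Sketch) (hl : 0 < X.l) (hk : 0 < X.k) (hM : 0 < X.M) (hB : 0 < X.B)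
    (G : ℕ) : (X.csp hl hk hM hB G).encode =
      Data.cons (Data.num (X.l + X.k))
        (Data.cons (Data.list (List.ofFn fun v : Fin (X.l + X.k) => Data.num (X.alphSize v)))
          (Data.list (List.ofFn fun u : Fin (X.l + X.k) => Data.list (List.ofFn
            fun v : Fin (X.l + X.k) => X.entry G u v)))) := by
  simp only [CSP.encode, Sketch.csp, Sketch.entry, Bool.decide_and]
  rfl

theorem Extends.encode (h : Extends Δ φ) (hE : Computable E) (ht : Computable t)
    (hpos : ∀ k, 0 < E k) {G : κ → ℕ} (hG : Δ.IsNat G) :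
    Δ.Evaluates (fun x => Data.cons (Data.num (numVars (E (φ x).k) (φ x).k))
      (Data.cons (Data.list (List.ofFn fun v : Fin (numVars (E (φ x).k) (φ x).k) =>
        Data.num (((φ x).sketch E t).alphSize v)))
        (Data.list (List.ofFn fun u : Fin (numVars (E (φ x).k) (φ x).k) => Data.list (List.ofFn
          fun v : Fin (numVars (E (φ x).k) (φ x).k) =>
            ((φ x).sketch E t).entry (G x) u v))))) := by
  have hn : Δ.IsNat (fun x => numVars (E (φ x).k) (φ x).k) := h.ofPar (computable_numVars hE)
  have h1 := h.below fun x => numVars (E (φ x).k) (φ x).k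
  have h2 := h1.below fun x => numVars (E (φ x.1).k) (φ x.1).k
  exact hn.1.cons ((Ctx.Evaluates.ofFn' hn (h1.alphSize hE hn.idx).1).cons
    (Ctx.Evaluates.ofFn' hn (Ctx.Evaluates.ofFn' hn.lift (h2.entry hE ht hpos hG.lift.lift
      hn.idx.lift hn.lift.idx (fun x => x.1.2.2.le) fun x => x.2.2.le))))

theorem evaluates_instances (hE : Computable E) (ht : Computable t) (hpos : ∀ k, 0 < E k) :
    inputCtx.Evaluates (fun x =>
      Data.list ((instances (hpos x.k) (t x.k) x.k x.I x.r).map CSP.encode)) := by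
  have hΓ : inputCtx.IsNat (fun x => numGuesses (E x.k) x.k) :=
    extends_inputCtx.ofPar (computable_numGuesses hE)
  refine (Ctx.Evaluates.ofFn' hΓ ((extends_inputCtx.below fun x => numGuesses (E x.k) x.k).encode
    hE ht hpos hΓ.idx)).of_eq fun x => ?_
  rw [instances, List.map_ofFn]
  congr 2
  funext G
  exact (Sketch.encode_csp (x.sketch E t) (numBlocks_pos (hpos x.k) x.k) (pos_of_lt_numGuesses G.2)
    (Nat.succ_pos _) (Nat.succ_pos _) G).symm

end Reduction

/-! ### Computable choice of the precision -/

theorem Computable.sum_range {f : ℕ → ℕ} (hf : Computable f) :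
    Computable fun n => ∑ j ∈ Finset.range n, f j := by
  refine (Computable.nat_rec (h := fun _ (y : ℕ × ℕ) => y.2 + f y.1) Computable.id
    (Computable.const 0) (Computable.natAdd (Computable.snd.comp .snd)
      (hf.comp (Computable.fst.comp .snd)))).of_eq fun n => ?_
  simp only [id]
  induction n with
  | zero => rfl
  | succ n ih => rw [Finset.sum_range_succ, ← ih]

theorem exists_computable_choice {P : ℕ → ℕ → Bool} (hP : Computable₂ P)
    (h : ∀ k, ∃ n, P k n = true) : ∃ F : ℕ → ℕ, Computable F ∧ ∀ k, P k (F k) = true := by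
  refine ⟨fun k => Nat.find (h k), ?_, fun k => Nat.find_spec (h k)⟩
  refine (Partrec.rfind (p := fun k n => Part.some (P k n)) hP.partrec₂).of_eq fun k => ?_
  refine Part.eq_some_iff.2 (Nat.mem_rfind.2 ⟨?_, fun {m} hm => ?_⟩)
  · exact Part.mem_some_iff.2 (Nat.find_spec (h k)).symm
  · exact Part.mem_some_iff.2 (Bool.eq_false_of_not_eq_true (Nat.find_min (h k) hm)).symm

/-- The decidable condition 2 ≤ m certifies a lower bound for the real number a. By `two_le_approx`
it holds for large n, so a search for it terminates. -/
theorem le_of_two_le_approx {a : ℝ} {m n : ℕ} (h : |a - (m : ℝ) / ((n : ℝ) + 1)| ≤ 1 / ((n : ℝ) + 1))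
    (hm : 2 ≤ m) : 1 ≤ ((n : ℝ) + 1) * a := by
  have hn : (0 : ℝ) < (n : ℝ) + 1 := by positivity
  have h1 := mul_le_mul_of_nonneg_left (abs_le.1 h).1 hn.le
  have hm' : (2 : ℝ) ≤ m := by exact_mod_cast hm
  field_simp at h1
  linarith

theorem two_le_approx {a : ℝ} {m n : ℕ} (h : |a - (m : ℝ) / ((n : ℝ) + 1)| ≤ 1 / ((n : ℝ) + 1))
    (hn : 3 ≤ (n : ℝ) * a) (ha : 0 < a) : 2 ≤ m := by
  have hn' : (0 : ℝ) < (n : ℝ) + 1 := by positivity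
  have h1 := mul_le_mul_of_nonneg_left (abs_le.1 h).2 hn'.le
  field_simp at h1
  have : (2 : ℝ) ≤ m := by linarith
  exact_mod_cast this

/-- `1 / E` is a sufficient precision for the density `τ` and the relative gap `δ`, and `t / E` is
slightly below `τ`. -/
def IsPrecision (τ δ : ℝ) (E t : ℕ) : Prop :=
  0 < E ∧ 10 ≤ E * δ * τ ∧ E * τ - 5 ≤ t ∧ (t : ℝ) ≤ E * τ - 2

/-- The number m - 3 lies between Eτ - 4 and Eτ - 2. The subtraction is not truncated, since Eδτ ≥
10 and δ ≤ 1/2 force Eτ ≥ 20. -/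
theorem IsPrecision.of_approx {τ δ : ℝ} {E m : ℕ} (hE : 0 < E) (hτ : 0 < τ) (hδ : δ ≤ 1 / 2)
    (h : 10 ≤ E * δ * τ) (hm : |E * τ - (m : ℝ)| ≤ 1) : IsPrecision τ δ E (m - 3) := by
  obtain ⟨h1, h2⟩ := abs_le.1 hm
  have hEτ : (20 : ℝ) ≤ E * τ := by
    have : (0 : ℝ) ≤ E * τ := by positivity
    nlinarith
  have h3 : 3 ≤ m := by
    have : (3 : ℝ) ≤ m := by linarith
    exact_mod_cast this
  refine ⟨hE, h, ?_, ?_⟩ <;> push_cast [Nat.cast_sub h3] <;> linarith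

/-- For constant sequences, one pair of numbers works for all k. It need not be found effectively,
so arbitrary reals are allowed. -/
theorem exists_precision_of_const {τ δ : ℝ} (hτ : 0 < τ) (hδ : 0 < δ) (hδ' : δ ≤ 1 / 2) :
    ∃ E t, IsPrecision τ δ E t := by
  obtain ⟨E, hE⟩ := exists_nat_ge (10 / (δ * τ))
  have h := (div_le_iff₀ (mul_pos hδ hτ)).1 hE
  have hpos : 0 < E := by
    rcases Nat.eq_zero_or_pos E with rfl | h'
    · norm_num at h
    · exact h'
  refine ⟨E, _, .of_approx (m := ⌊(E : ℝ) * τ⌋₊) hpos hτ hδ' (by linarith) (abs_le.2 ⟨?_, ?_⟩)⟩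
  · linarith [Nat.floor_le (a := (E : ℝ) * τ) (by positivity)]
  · linarith [Nat.lt_floor_add_one ((E : ℝ) * τ)]

theorem exists_precision_of_computable {τ δ : ℕ → ℝ} (hτ : ∀ k, 0 < τ k)
    (hδ : ∀ k, 0 < δ k ∧ δ k ≤ 1 / 2) (hcτ : IsComputableSeq τ) (hcδ : IsComputableSeq δ) :
    ∃ E t : ℕ → ℕ, Computable E ∧ Computable t ∧ ∀ k, IsPrecision (τ k) (δ k) (E k) (t k) := by
  obtain ⟨f, hf, hfτ⟩ := hcτ
  obtain ⟨g, hg, hgδ⟩ := hcδ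
  obtain ⟨F, hF, hFP⟩ := exists_computable_choice
    (P := fun k n => decide (2 ≤ f k n) && decide (2 ≤ g k n)) (by
      have h2 : ∀ {f : ℕ → ℕ → ℕ}, Computable₂ f →
          Computable fun x : ℕ × ℕ => decide (2 ≤ f x.1 x.2) := fun hf =>
        Primrec.nat_le.decide.to_comp.comp (Computable.const 2) hf
      exact Primrec.and.to_comp.comp (h2 hf) (h2 hg)) fun k => by
    obtain ⟨n, hn⟩ := exists_nat_ge (max (3 / τ k) (3 / δ k))
    rw [max_le_iff, div_le_iff₀ (hτ k), div_le_iff₀ (hδ k).1] at hn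
    refine ⟨n, ?_⟩
    rw [Bool.and_eq_true, decide_eq_true_iff, decide_eq_true_iff]
    exact ⟨two_le_approx (hfτ k n) hn.1 (hτ k), two_le_approx (hgδ k n) hn.2 (hδ k).1⟩
  -- The search certifies that τ and δ are at least 1/(F + 1), so E = 10 (F + 1)² gives Eδτ ≥ 10.
  -- The predecessor of E appears because the approximation with index n has denominator n + 1.
  have hE : Computable fun k => 10 * ((F k + 1) * (F k + 1)) - 1 := by
    have h1 := Computable.natAdd hF (Computable.const 1)
    exact Primrec.nat_sub.to_comp.comp (Computable.natMul (Computable.const 10)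
      (Computable.natMul h1 h1)) (Computable.const 1)
  have hpos : ∀ k, 0 < 10 * ((F k + 1) * (F k + 1)) := fun k => by positivity
  refine ⟨fun k => 10 * ((F k + 1) * (F k + 1)) - 1 + 1,
    fun k => f k (10 * ((F k + 1) * (F k + 1)) - 1) - 3, Computable.natAdd hE (Computable.const 1),
    Primrec.nat_sub.to_comp.comp (hf.comp Computable.id hE) (Computable.const 3), fun k => ?_⟩
  have hP := hFP k
  rw [Bool.and_eq_true, decide_eq_true_iff, decide_eq_true_iff] at hP
  have h1 := le_of_two_le_approx (hfτ k _) hP.1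
  have h2 := le_of_two_le_approx (hgδ k _) hP.2
  beta_reduce
  refine .of_approx (Nat.succ_pos _) (hτ k) (hδ k).2 ?_ ?_
  · rw [Nat.sub_add_cancel (hpos k)]
    push_cast
    nlinarith [mul_le_mul h1 h2 zero_le_one (zero_le_one.trans h1)]
  · have h3 := hfτ k (10 * ((F k + 1) * (F k + 1)) - 1)
    generalize 10 * ((F k + 1) * (F k + 1)) - 1 = e at h3 ⊢
    have he : (0 : ℝ) < (e : ℝ) + 1 := by positivity
    have h4 := mul_le_mul_of_nonneg_left h3 he.le
    rw [← abs_of_pos he, ← abs_mul, abs_of_pos he, mul_sub, mul_div_cancel₀ _ he.ne',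
      mul_div_cancel₀ _ he.ne'] at h4
    exact_mod_cast h4

theorem exists_precision {τ δ : ℕ → ℝ} (hτ : ∀ k, 0 < τ k) (hδ : ∀ k, 0 < δ k ∧ δ k ≤ 1 / 2)
    (hcomp : (IsComputableSeq τ ∧ IsComputableSeq δ) ∨
      ((∃ a : ℝ, ∀ k, τ k = a) ∧ (∃ d : ℝ, ∀ k, δ k = d))) :
    ∃ E t : ℕ → ℕ, Computable E ∧ Computable t ∧ ∀ k, IsPrecision (τ k) (δ k) (E k) (t k) := by
  rcases hcomp with ⟨h1, h2⟩ | ⟨⟨a, ha⟩, d, hd⟩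
  · exact exists_precision_of_computable hτ hδ h1 h2
  · obtain ⟨E, t, h⟩ := exists_precision_of_const (hτ 0) (hδ 0).1 (hδ 0).2
    exact ⟨fun _ => E, fun _ => t, Computable.const E, Computable.const t,
      fun k => by rwa [ha, hd, ← ha 0, ← hd 0]⟩

/-! ### The randomized algorithm -/

/-- The same bound covers the running time and the number of coins needed, so R coins suffice as
soon as R exceeds the time bound. The oracle is arbitrary because the program is reused inside the
Turing reduction. -/
theorem exists_program {E t : ℕ → ℕ} (hE : Computable E) (ht : Computable t) (hpos : ∀ k, 0 < E k) :
    ∃ (A : Prog) (T : ℕ → ℕ) (q : Polynomial ℕ), Computable T ∧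
      ∀ (O : Set Data) (k : ℕ) (I : SetSystem), 0 < I.u →
        numBlocks (E k) k * blockSize k I * bitsPerSample (E k) I ≤ T k * q.eval I.size ∧
        ∀ (R : ℕ) (r : Fin R → Bool), ∃ s ≤ T k * q.eval I.size,
          Runs O A (withCoins (Data.cons (Data.num k) I.encode) r)
            (Data.list ((instances (hpos k) (t k) k I r).map CSP.encode)) s := by
  obtain ⟨A, b, hb, hA⟩ := evaluates_instances hE ht hpos
  have hbits := (((extends_inputCtx.numBlocks hE).mul extends_inputCtx.blockSize).mul
    (extends_inputCtx.bitsPerSample hE)).bdd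
  obtain ⟨T, q, hT, hq⟩ := hb.add hbits
  refine ⟨A, T, q, hT, fun O k I hu => ⟨?_, fun R r => ?_⟩⟩
  · exact (Nat.le_add_left _ _).trans (hq ⟨O, k, I, 0, Fin.elim0, hu⟩)
  · obtain ⟨s, hs, hr⟩ := hA ⟨O, k, I, R, r, hu⟩
    exact ⟨s, hs.trans ((Nat.le_add_right _ _).trans (hq ⟨O, k, I, R, r, hu⟩)), hr⟩

theorem coinProb_mono {R : ℕ} {A B : Set (Fin R → Bool)} (h : A ⊆ B) :
    coinProb R A ≤ coinProb R B := by
  rw [coinProb, coinProb]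
  gcongr
  exact Set.toFinite B

theorem Representative.correct {E t k R : ℕ} {I : SetSystem} {r : Fin R → Bool} {τ δ : ℝ}
    (hr : Representative E k I r) (h : IsPrecision τ δ E t) (hu : 0 < I.u) (hτ : 0 < τ)
    (hδ : 0 < δ ∧ δ ≤ 1 / 2) :
    (I.CoversAtLeast k τ → ∃ P ∈ instances h.1 t k I r, P.Satisfiable) ∧
    (I.CoversAtMost k ((1 - δ) * τ) →
      ∀ P ∈ instances h.1 t k I r, P.ValueAtMost (1 - δ ^ 2 / 4)) :=
  ⟨exists_instance_satisfiable h.1 hu hr hτ h.2.2.2,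
    instances_valueAtMost h.1 hu hr hτ hδ.1 hδ.2 h.2.1 h.2.2.1⟩

theorem exists_randomized_algorithm {τ δ : ℕ → ℝ} (hτ : ∀ k, 0 < τ k)
    (hδ : ∀ k, 0 < δ k ∧ δ k ≤ 1 / 2) {E t : ℕ → ℕ} (hE : Computable E) (ht : Computable t)
    (hp : ∀ k, IsPrecision (τ k) (δ k) (E k) (t k)) :
    ∃ (A : Prog) (T Γ Λ : ℕ → ℕ) (q q' : Polynomial ℕ) (err : ℕ → ℝ),
      Computable T ∧ Computable Γ ∧ Computable Λ ∧ Tendsto err atTop (𝓝 0) ∧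
      ∀ (k : ℕ) (I : SetSystem), 0 < I.u → ∀ R : ℕ, T k * q.eval I.size ≤ R →
        (∀ r : Fin R → Bool, ∃ (w : Data) (s : ℕ),
          Runs ∅ A (withCoins (Data.cons (Data.num k) I.encode) r) w s ∧
          s ≤ T k * q.eval I.size) ∧
        1 - err I.size ≤ coinProb R {r | ∃ (Ps : List CSP) (s : ℕ),
          Runs ∅ A (withCoins (Data.cons (Data.num k) I.encode) r)
            (Data.list (Ps.map CSP.encode)) s ∧
          Ps.length = Γ k ∧
          (∀ P ∈ Ps, P.n = Λ k ∧ ∀ v, P.alph v ≤ q'.eval I.size) ∧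
          (I.CoversAtLeast k (τ k) → ∃ P ∈ Ps, P.Satisfiable) ∧
          (I.CoversAtMost k ((1 - δ k) * τ k) →
            ∀ P ∈ Ps, P.ValueAtMost (1 - δ k ^ 2 / 4))} := by
  obtain ⟨A, T, q, hT, hA⟩ := exists_program hE ht fun k => (hp k).1
  refine ⟨A, T, fun k => numGuesses (E k) k, fun k => numVars (E k) k, q,
    (.X + 2) * (.X + 6), fun N => 2 / ((N : ℝ) + 6), hT, computable_numGuesses hE,
    computable_numVars hE, ?_, fun k I hu R hR => ⟨fun r => ?_, ?_⟩⟩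
  · exact tendsto_const_nhds.div_atTop
      (tendsto_atTop_add_const_right _ _ tendsto_natCast_atTop_atTop)
  · obtain ⟨s, hs, hr⟩ := (hA ∅ k I hu).2 R r
    exact ⟨_, s, hr, hs⟩
  · refine (coinProb_representative (hp k).1 hu ((hA ∅ k I hu).1.trans hR)).trans
      (coinProb_mono fun r hr => ?_)
    obtain ⟨s, -, hs⟩ := (hA ∅ k I hu).2 R r
    refine ⟨_, s, hs, by simp [instances], ?_, hr.correct (hp k) hu (hτ k) (hδ k)⟩
    simpa using instances_size (hp k).1

/-! ### The randomized Turing reduction -/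

/-- The program in which all queries are answered by `nil`. -/
def Prog.withoutQueries : Prog → Prog
  | .id => .id
  | .nil => .nil
  | .hd => .hd
  | .tl => .tl
  | .cons f g => .cons f.withoutQueries g.withoutQueries
  | .comp g f => .comp g.withoutQueries f.withoutQueries
  | .cond c f g => .cond c.withoutQueries f.withoutQueries g.withoutQueries
  | .loop c f => .loop c.withoutQueries f.withoutQueries
  | .query => .nil

/-- An FPT reduction is specified for the empty oracle, which answers `nil` throughout. As a
subroutine it must behave in the same way under any oracle. -/
theorem Runs.withoutQueries {p : Prog} {v w : Data} {t : ℕ} (h : Runs ∅ p v w t) (O : Set Data) :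
    Runs O p.withoutQueries v w t := by
  induction h with
  | id v => exact .id v
  | nil v => exact .nil v
  | hd v => exact .hd v
  | tl v => exact .tl v
  | cons _ _ h1 h2 => exact .cons h1 h2
  | comp _ _ h1 h2 => exact .comp h1 h2
  | cond_true _ hne _ h1 h2 => exact .cond_true h1 hne h2
  | cond_false _ _ h1 h2 => exact .cond_false h1 h2
  | loop_done _ h1 => exact .loop_done h1
  | loop_step _ hne _ _ h1 h2 h3 => exact .loop_step h1 hne h2 h3
  | query_yes h => exact absurd h (Set.notMem_empty _)
  | query_no => exact .nil _

namespace Data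

def depth : Data → ℕ
  | nil => 0
  | cons a b => max a.depth b.depth + 1

theorem depth_hd_le (v : Data) : v.hd.depth ≤ v.depth := by
  cases v with
  | nil => exact le_rfl
  | cons a b => exact (le_max_left _ _).trans (Nat.le_succ _)

theorem depth_tl_le (v : Data) : v.tl.depth ≤ v.depth := by
  cases v with
  | nil => exact le_rfl
  | cons a b => exact (le_max_right _ _).trans (Nat.le_succ _)

theorem depth_le_size (v : Data) : v.depth ≤ v.size := by
  induction v with
  | nil => exact Nat.zero_le _
  | cons a b ha hb => simp only [depth, size]; omega

theorem length_le_depth_list (l : List Data) : l.length ≤ (list l).depth := by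
  induction l with
  | nil => exact le_rfl
  | cons a l ih => simp only [list, depth, List.length_cons]; omega

theorem depth_num (n : ℕ) : (num n).depth = n := by
  induction n with
  | zero => rfl
  | succ n ih => simp [num_succ, depth, ih]

end Data

/-- Depth is the right measure here: sharing lets a single cons double the size, while it adds at
most one to the maximal depth of its parts. -/
theorem Runs.depth_le {O : Set Data} {p : Prog} {v w : Data} {t : ℕ} (h : Runs O p v w t) :
    w.depth ≤ v.depth + t := by
  induction h with
  | id v => exact Nat.le_add_right _ _
  | nil v => exact Nat.zero_le _
  | hd v => exact v.depth_hd_le.trans (Nat.le_add_right _ _)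
  | tl v => exact v.depth_tl_le.trans (Nat.le_add_right _ _)
  | cons _ _ h1 h2 => simp only [Data.depth]; omega
  | comp _ _ h1 h2 => omega
  | cond_true _ _ _ _ h2 => omega
  | cond_false _ _ _ h2 => omega
  | loop_done _ _ => omega
  | loop_step _ _ _ _ _ h2 h3 => omega
  | query_yes _ => simp only [Data.bit, Data.depth]; omega
  | query_no _ => exact Nat.zero_le _

/-- Both the unary universe size and the list of sets show up in the depth of the encoding. So the
running time of a reduction bounds the size of the set system it produces. -/
theorem SetSystem.size_le_depth (I : SetSystem) : I.size ≤ 2 * I.encode.depth := by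
  have h1 := Data.length_le_depth_list (I.sets.map fun s =>
    Data.list (List.ofFn fun x : Fin I.u => Data.bit (decide (x ∈ s))))
  simp only [SetSystem.size, SetSystem.encode, Data.depth, Data.depth_num, List.length_map] at h1 ⊢
  omega

theorem CSP.hd_encode (P : CSP) : P.encode.hd = Data.num P.n := rfl

/-- An input of a parameterized problem, with random bits and an oracle. -/
structure RandInput where
  oracle : Set Data
  k : ℕ
  x : Data
  R : ℕ
  r : Fin R → Bool

/-- The inputs of a randomized program as a context. -/
def randCtx : Ctx RandInput where
  par := fun y => y.k
  len := fun y => y.x.size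
  oracle := fun y => y.oracle
  env := fun y => withCoins (Data.cons (Data.num y.k) y.x) y.r

/-- A deterministic reduction from `L` to the coverage problem with fixed witnesses. -/
theorem exists_setSystem {L : ℕ → Set Data} {τ : ℕ → ℝ} {d : ℝ}
    (h : FPTReduces (ofLanguage L) (gapMaxCov τ d)) :
    ∃ (p : Prog) (T g : ℕ → ℕ) (q : Polynomial ℕ) (k' : ℕ → Data → ℕ) (I : ℕ → Data → SetSystem),
      Computable T ∧ Computable g ∧ ∀ k x, (∃ t ≤ T k * q.eval x.size,
        Runs ∅ p (Data.cons (Data.num k) x)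
          (Data.cons (Data.num (k' k x)) (I k x).encode) t) ∧ k' k x ≤ g k ∧ 0 < (I k x).u ∧
        (x ∈ L k → (I k x).CoversAtLeast (k' k x) (τ (k' k x))) ∧
        (x ∉ L k → (I k x).CoversAtMost (k' k x) ((1 - d) * τ (k' k x))) := by
  obtain ⟨p, T, g, q, hT, hg, h⟩ := h
  have : ∀ k x, ∃ (k' : ℕ) (I : SetSystem), (∃ t ≤ T k * q.eval x.size,
        Runs ∅ p (Data.cons (Data.num k) x) (Data.cons (Data.num k') I.encode) t) ∧
        k' ≤ g k ∧ 0 < I.u ∧ (x ∈ L k → I.CoversAtLeast k' (τ k')) ∧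
        (x ∉ L k → I.CoversAtMost k' ((1 - d) * τ k')) := by
    intro k x
    by_cases hx : x ∈ L k
    · obtain ⟨k', y, t, hr, ht, hk', hy, -⟩ := h k x (.inl hx)
      obtain ⟨I, hu, rfl, hI⟩ := hy hx
      exact ⟨k', I, ⟨t, ht, hr⟩, hk', hu, fun _ => hI, fun hx' => absurd hx hx'⟩
    · obtain ⟨k', y, t, hr, ht, hk', -, hy⟩ := h k x (.inr hx)
      obtain ⟨I, hu, rfl, hI⟩ := hy hx
      exact ⟨k', I, ⟨t, ht, hr⟩, hk', hu, fun hx' => absurd hx' hx, fun _ => hI⟩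
  choose k' I h' using this
  exact ⟨p, T, g, q, k', I, hT, hg, h'⟩

open Classical in
/-- Some program counts the elements `y` of a list for which the oracle contains the pair of the
head of `y` and `y`. -/
theorem Ctx.Evaluates.countQueries {ι : Type} {Γ : Ctx ι} {xs : ι → List Data}
    (hxs : Γ.Evaluates fun i => Data.list (xs i)) (hb : Γ.Bounded fun i => (xs i).length) :
    Γ.EvalNat fun i => Nat.count (fun j => decide
      (Data.cons ((Data.list (xs i)).nth j).hd ((Data.list (xs i)).nth j) ∈ Γ.oracle i) = true)
      (xs i).length := by
  refine EvalNat.count (fun i j => decide (Data.cons ((Data.list (xs i)).nth j).hd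
    ((Data.list (xs i)).nth j) ∈ Γ.oracle i)) (.length hxs hb) hb ?_
  have hn := Evaluates.nth (hxs.lift_below (n := fun i => (xs i).length)) .idx hb.idx_below
  exact .query (hn.hd.cons hn) _ fun x => decide_eq_true_iff

theorem le_sum_range {f : ℕ → ℕ} {j m : ℕ} (h : j ≤ m) :
    f j ≤ ∑ i ∈ Finset.range (m + 1), f i :=
  Finset.single_le_sum (f := f) (fun _ _ => Nat.zero_le _) (Finset.mem_range.2 (Nat.lt_succ_of_le h))

theorem count_pos_iff {p : ℕ → Bool} {n : ℕ} :
    Data.num (Nat.count (fun j => p j = true) n) ≠ Data.nil ↔ ∃ j < n, p j = true := by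
  rw [Ne, Data.num_eq_nil, Nat.count_iff_forall_not]
  push Not
  rfl

/-- Accept if the oracle affirms some instance. For a representative sample, a YES input has a
satisfiable instance, and arbitrary answers on the others do no harm; for a NO input every instance
has small value and is rejected. -/
theorem randTuringReduces_gap2CSP {L : ℕ → Set Data} {τ : ℕ → ℝ} {d : ℝ} (hτ : ∀ k, 0 < τ k)
    (hd : 0 < d ∧ d ≤ 1 / 2) {E t : ℕ → ℕ} (hE : Computable E) (ht : Computable t)
    (hp : ∀ k, IsPrecision (τ k) d (E k) (t k))
    (h : FPTReduces (ofLanguage L) (gapMaxCov τ d)) :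
    RandTuringReduces (ofLanguage L) (gap2CSP (1 - d ^ 2 / 4)) := by
  obtain ⟨p, T₁, g₁, q₁, κ, I, hT₁, hg₁, hred⟩ := exists_setSystem h
  obtain ⟨A, T₂, q₂, hT₂, hA⟩ := exists_program hE ht fun k => (hp k).1
  -- The new parameter depends on x, but is at most `g₁ k`. Summing f over this range bounds its
  -- value there by a computable function of k, without monotonicity of f.
  have sum_computable : ∀ {f : ℕ → ℕ}, Computable f →
      Computable fun k => ∑ j ∈ Finset.range (g₁ k + 1), f j := fun hf =>
    (Computable.sum_range hf).comp (Computable.natAdd hg₁ (.const 1))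
  have bounded_sum : ∀ {f : ℕ → ℕ}, Computable f →
      randCtx.Bounded fun y => f (κ y.k y.x) := fun hf =>
    (Ctx.Bounded.par (Γ := randCtx) (sum_computable hf)).mono fun y => le_sum_range (hred y.k y.x).2.1
  have htime : randCtx.Bounded fun y => T₁ y.k * q₁.eval y.x.size := ⟨T₁, q₁, hT₁, fun _ => le_rfl⟩
  have hsize : randCtx.Bounded fun y => (I y.k y.x).size := by
    refine ((Ctx.Bounded.const 2).mul ((((Ctx.Bounded.par Computable.id).add .len).add
      (.const 1)).add htime)).mono fun y => ?_
    obtain ⟨⟨s, hs, hr⟩, -⟩ := hred y.k y.x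
    have h1 := hr.depth_le
    have h2 := (I y.k y.x).size_le_depth
    have h3 := y.x.depth_le_size
    simp only [Data.depth, Data.depth_num] at h1
    change _ ≤ 2 * (y.k + y.x.size + 1 + _)
    omega
  have hcost : randCtx.Bounded fun y => T₂ (κ y.k y.x) * q₂.eval (I y.k y.x).size :=
    (bounded_sum hT₂).mul (hsize.eval q₂)
  set out : RandInput → List CSP := fun y =>
    instances (hp (κ y.k y.x)).1 (t (κ y.k y.x)) (κ y.k y.x) (I y.k y.x) y.r with hout
  have hinst : randCtx.Evaluates fun y => Data.cons (Data.num (κ y.k y.x)) (I y.k y.x).encode :=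
    (Ctx.Evaluates.env (Γ := randCtx)).hd.comp ⟨p.withoutQueries, _, htime, fun y => by
      obtain ⟨⟨s, hs, hr⟩, -⟩ := hred y.k y.x
      exact ⟨s, hs, hr.withoutQueries y.oracle⟩⟩
  have hlist : randCtx.Evaluates fun y => Data.list ((out y).map CSP.encode) := by
    refine (hinst.cons (Ctx.Evaluates.env (Γ := randCtx)).tl).comp ⟨A, _, hcost, fun y => ?_⟩
    exact (hA y.oracle (κ y.k y.x) (I y.k y.x) (hred y.k y.x).2.2.1).2 y.R y.r
  have hlen : randCtx.Bounded fun y => ((out y).map CSP.encode).length :=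
    (bounded_sum (computable_numGuesses hE)).mono fun y => by simp [hout, instances]
  obtain ⟨B, b, hb, hB⟩ := Ctx.Evaluates.countQueries hlist hlen
  obtain ⟨T, q, hT, hq⟩ := hb.add hcost
  refine ⟨B, T, fun k => ∑ j ∈ Finset.range (g₁ k + 1), numVars (E j) j, q, hT,
    sum_computable (computable_numVars hE), fun k x _ O hO R hR => ?_⟩
  have hrun : ∀ r : Fin R → Bool, ∃ w, (∃ s ≤ T k * q.eval x.size,
      Runs O B (withCoins (Data.cons (Data.num k) x) r) w s) ∧
      (w ≠ Data.nil ↔ ∃ P ∈ out ⟨O, k, x, R, r⟩, Data.cons (Data.num P.n) P.encode ∈ O) := by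
    intro r
    obtain ⟨s, hs, hr⟩ := hB ⟨O, k, x, R, r⟩
    refine ⟨_, ⟨s, hs.trans ((Nat.le_add_right _ _).trans (hq ⟨O, k, x, R, r⟩)), hr⟩,
      count_pos_iff.trans ?_⟩
    simp only [decide_eq_true_iff, List.length_map, Data.nth_list]
    refine ⟨fun ⟨j, hj, hO⟩ => ⟨_, List.getElem_mem hj, ?_⟩, fun ⟨P, hP, hO⟩ => ?_⟩
    · simpa [hj, randCtx, CSP.hd_encode] using hO
    · obtain ⟨j, hj, rfl⟩ := List.getElem_of_mem hP
      exact ⟨j, hj, by simpa [hj, randCtx, CSP.hd_encode] using hO⟩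
  obtain ⟨-, hκ, hu, hyes, hno⟩ := hred k x
  have hprob : 2 / 3 ≤ coinProb R {r : Fin R → Bool |
      Representative (E (κ k x)) (κ k x) (I k x) r} := by
    refine le_trans ?_ (coinProb_representative (hp _).1 hu
      (((hA O _ _ hu).1.trans ((Nat.le_add_left _ _).trans
        (hq ⟨O, k, x, R, fun _ => true⟩))).trans hR))
    have : (2 : ℝ) / ((I k x).size + 6) ≤ 2 / 6 := by
      gcongr
      linarith [Nat.cast_nonneg (α := ℝ) (I k x).size]
    linarith
  -- All queried instances have `numVars` variables for the new parameter, within the range where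
  -- the oracle is reliable.
  have hsolve : ∀ (r : Fin R → Bool), ∀ P ∈ out ⟨O, k, x, R, r⟩,
      (P.Satisfiable → Data.cons (Data.num P.n) P.encode ∈ O) ∧
      (P.ValueAtMost (1 - d ^ 2 / 4) → Data.cons (Data.num P.n) P.encode ∉ O) := by
    intro r P hP
    have hn : P.n ≤ ∑ j ∈ Finset.range (g₁ k + 1), numVars (E j) j := by
      rw [(instances_size _ P hP).1]
      exact le_sum_range (f := fun j => numVars (E j) j) hκ
    exact ⟨fun h => (hO _ hn _).1 ⟨P, rfl, rfl, h⟩, fun h => (hO _ hn _).2 ⟨P, rfl, rfl, h⟩⟩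
  refine ⟨fun r => ?_, fun hx => hprob.trans (coinProb_mono fun r hr => ?_),
    fun hx => hprob.trans (coinProb_mono fun r hr => ?_)⟩
  · obtain ⟨w, ⟨s, hs, hw⟩, -⟩ := hrun r
    exact ⟨w, s, hw, hs⟩
  · obtain ⟨w, ⟨s, -, hw⟩, hiff⟩ := hrun r
    obtain ⟨P, hP, hsat⟩ := (hr.correct (hp _) hu (hτ _) hd).1 (hyes hx)
    exact ⟨w, s, hw, hiff.2 ⟨P, hP, (hsolve r P hP).1 hsat⟩⟩
  · obtain ⟨w, ⟨s, -, hw⟩, hiff⟩ := hrun r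
    have hnil : w = Data.nil := by
      by_contra hne
      obtain ⟨P, hP, hPO⟩ := hiff.1 hne
      exact (hsolve r P hP).2 ((hr.correct (hp _) hu (hτ _) hd).2 (hno hx) P hP) hPO
    exact ⟨s, hnil ▸ hw⟩

end MaxCovCSP

theorem theorem3p1 (τ δ : ℕ → ℝ) (hτ : ∀ k, 0 < τ k) (hδ : ∀ k, 0 < δ k ∧ δ k ≤ 1 / 2)
    (hcomp : (MaxCovCSP.IsComputableSeq τ ∧ MaxCovCSP.IsComputableSeq δ) ∨
      ((∃ a : ℝ, ∀ k, τ k = a) ∧ (∃ d : ℝ, ∀ k, δ k = d))) :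
    (∃ (A : MaxCovCSP.Prog) (T Γ Λ : ℕ → ℕ) (q q' : Polynomial ℕ) (err : ℕ → ℝ),
      Computable T ∧ Computable Γ ∧ Computable Λ ∧ Tendsto err atTop (𝓝 0) ∧
      ∀ (k : ℕ) (I : MaxCovCSP.SetSystem), 0 < I.u → ∀ R : ℕ, T k * q.eval I.size ≤ R →
        (∀ r : Fin R → Bool, ∃ (w : MaxCovCSP.Data) (t : ℕ),
          MaxCovCSP.Runs ∅ A
            (MaxCovCSP.withCoins (MaxCovCSP.Data.cons (MaxCovCSP.Data.num k) I.encode) r) w t ∧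
          t ≤ T k * q.eval I.size) ∧
        1 - err I.size ≤ MaxCovCSP.coinProb R {r | ∃ (Ps : List MaxCovCSP.CSP) (t : ℕ),
          MaxCovCSP.Runs ∅ A
            (MaxCovCSP.withCoins (MaxCovCSP.Data.cons (MaxCovCSP.Data.num k) I.encode) r)
            (MaxCovCSP.Data.list (Ps.map MaxCovCSP.CSP.encode)) t ∧
          Ps.length = Γ k ∧
          (∀ P ∈ Ps, P.n = Λ k ∧ ∀ v, P.alph v ≤ q'.eval I.size) ∧
          (I.CoversAtLeast k (τ k) → ∃ P ∈ Ps, P.Satisfiable) ∧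
          (I.CoversAtMost k ((1 - δ k) * τ k) → ∀ P ∈ Ps, P.ValueAtMost (1 - δ k ^ 2 / 4))}) ∧
    (∀ d : ℝ, (∀ k, δ k = d) → MaxCovCSP.W1Hard (MaxCovCSP.gapMaxCov τ d) →
      MaxCovCSP.W1HardRandTuring (MaxCovCSP.gap2CSP (1 - d ^ 2 / 4))) := by
  obtain ⟨E, t, hE, ht, hp⟩ := MaxCovCSP.exists_precision hτ hδ hcomp
  refine ⟨MaxCovCSP.exists_randomized_algorithm hτ hδ hE ht hp, fun d hd hard L hL => ?_⟩
  exact MaxCovCSP.randTuringReduces_gap2CSP hτ (hd 0 ▸ hδ 0) hE ht (fun k => hd k ▸ hp k)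
    (hard L hL)
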